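/- **Theorem (Growth of centralizers).** Let $q$ be an odd prime power and let $Sp_n(q)$ be the group of isometries of the symplectic space $V_n=\mathbb F_q^{2n}$ with hyperbolic basis $e_1,\dots,e_n,f_1,\dots,f_n$ ($Q(e_i,f_j)=\delta_{ij}$, $Q(e_i,e_j)=Q(f_i,f_j)=0$). For $m\le n$ embed $Sp_m(q)$ into $Sp_n(q)$ by $U\mapsto U^{\uparrow\uparrow n}=\mathrm{diag}(U,1)$ with respect to $V_n=V_m\perp V_{m,n}$, where $V_{m,n}$ is spanned by $e_{m+1},\dots,e_n,f_{m+1},\dots,f_n$. Let $\Phi$ be the set of monic irreducible polynomials in $\mathbb F_q[t]$ other than $t$. The type of a matrix $U \in Sp_m(q)$ is the function $\lambda$ from $\Phi$ to partitions with $V_m\cong\bigoplus_{f}\bigoplus_i \mathbb F_q[t]/(f^{\lambda(f)_i})$ as $\mathbb F_q[t]$-module, where $t$ acts as $U$; its weight is $\|\lambda\|=\sum_f\deg f\cdot|\lambda(f)|$. The modified type $\eta=\mathring\lambda$ is obtained by subtracting $1$ from all parts of $\lambda(t-1)$ (discarding zeros), and the completion $\overline\eta$ by adding $1$ to all parts of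 $\eta(t-1)$. The reflection length $rl(g)$ is the least number of factors in a factorization of $g$ in $GL_{2m}(q)$ into reflections, i.e. elements $r$ with $\operatorname{rank}(r-1)=1$. $C_G(\cdot)$ denotes the centralizer in $G$. Let $m\le n$, let $U\in Sp_m(q)$ have modified type $\eta$ with $\|\overline{\eta}\|=2m$ (that is, the Jordan form of $U$ has no identity block), and let $d=\dim V^U$, $V^U=\ker(U-1)$. 1. $|C_{Sp_n(q)}(U^{\uparrow\uparrow n})|=|C_{Sp_m(q)}(U)|\cdot|Sp_{n-m}(q)|\cdot q^{2d(n-m)}$. 2. If $U=U_1U_2$ with $U_1,U_2\in Sp_m(q)$ and $rl(U_1)+rl(U_2)=rl(U)$, then $$|C_{Sp_n(q)}(U_1^{\uparrow\uparrow n})\cap C_{Sp_n(q)}(U_2^{\uparrow\uparrow n})|=|C_{Sp_m(q)}(U_1)\cap C_{Sp_m(q)}(U_2)|\cdot|Sp_{n-m}(q)|\cdot q^{2d(n-m)}.$$ 3. Block descriptions. Some $Sp_m(q)$-conjugate $TUT^{-1}$ of $U$ has a fixed space that is spanned by a subset of the basis $e_1,\dots,e_m,f_1,\dots,f_m$. Suppose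 that $V^U$ itself is spanned by a subset $B_p$ of this basis (the pivotal basis elements). For a basis vector $a$ let $a'$ be its hyperbolic conjugate ($e_i'=f_i$, $f_i'=e_i$), and let $B_l=\{a':a\in B_p\}$ (the leading basis elements). For a matrix $M=\begin{pmatrix}M_{11}&M_{12}\\M_{21}&M_{22}\end{pmatrix}$ in block form with respect to $V_n=V_m\perp V_{m,n}$, let $C_u(\cdot)$ denote the column with label $u$, put $L=\big((M_{11})_{a',b'}\big)_{a,b\in B_p}$, let $\sigma$ be the diagonal sign matrix $\mathrm{diag}(Q(a',a))_{a\in B_p}$, and for a matrix $A=(A_{ab})_{a,b\in B_p}$ let $\overline A$ be the $2m\times 2m$ matrix with entry $A_{ab}$ at position $(a,b')$ and zeros elsewhere. Then $C_{Sp_n(q)}(U^{\uparrow\uparrow n})$ is the set of all such $M$ with - $M_{22}\in Sp_{n-m}(q)$, $UM_{12}=M_{12}$, $M_{21}U=M_{21}$; - $(M_{12})_{a,v}=-\big((L^{t}\sigma)^{-1}\,(Q(C_{b'}(M_{21}),C_w(M_{22})))_{b,w}\big)_{a,v}$ for $a\in B_p$ and all basis vectors $v$ of $V_{m,n}$; -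 $M_{11}+\tfrac12\,\overline{(L^{t}\sigma)^{-1}\,(Q(C_{a'}(M_{21}),C_{b'}(M_{21})))_{a,b\in B_p}}\in C_{Sp_m(q)}(U)$. If moreover $U=U_1U_2$ is as in 2, then $C_{Sp_n(q)}(U_1^{\uparrow\uparrow n})\cap C_{Sp_n(q)}(U_2^{\uparrow\uparrow n})$ is described by the same conditions with $C_{Sp_m(q)}(U)$ in the last one replaced by $C_{Sp_m(q)}(U_1)\cap C_{Sp_m(q)}(U_2)$. -/

import Mathlib

open scoped Polynomial DirectSum

noncomputable section

/-! ### Partition valued functions and types of matrices -/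

/-- The set `Φ` of monic irreducible polynomials over `F` other than `t`. -/
abbrev Phi (F : Type*) [Field F] : Type _ :=
  {f : F[X] // f.Monic ∧ Irreducible f ∧ f ≠ Polynomial.X}

/-- The polynomial `t - 1`, as an element of `Φ`. -/
def phiOne (F : Type*) [Field F] : Phi F :=
  ⟨Polynomial.X - Polynomial.C 1, Polynomial.monic_X_sub_C 1, Polynomial.irreducible_X_sub_C 1,
    fun h => by
      have h0 := congrArg (Polynomial.eval 0) h
      simp at h0⟩

/-- A partition: a finite multiset of positive integers, its parts. -/
abbrev IntPartition : Type := Multiset ℕ+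

namespace IntPartition

/-- The sum of the parts. -/
def weight (p : IntPartition) : ℕ := (p.map (fun k : ℕ+ => (k : ℕ))).sum

/-- Subtract `1` from every part (parts equal to `1` disappear). -/
def modification (p : IntPartition) : IntPartition :=
  p.filterMap fun k => if 1 < k then some (k - 1) else none

/-- Add `1` to every part. -/
def completion (p : IntPartition) : IntPartition := p.map fun k => k + 1

end IntPartition

/-- A partition valued function on `Φ`: almost all values are the empty partition. -/
abbrev PartFun (F : Type*) [Field F] : Type _ := Phi F →₀ IntPartition

namespace PartFun

variable {F : Type*} [Field F]

/-- The weight `‖lam‖ = ∑ f, deg f * ‖lam f‖`. -/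
def weight (lam : PartFun F) : ℕ := lam.sum fun f p => f.1.natDegree * IntPartition.weight p

/-- Modification: the partition at `t - 1` is modified, the others are kept. -/
def modification (lam : PartFun F) : PartFun F :=
  lam.update (phiOne F) (IntPartition.modification (lam (phiOne F)))

/-- Completion: the partition at `t - 1` is completed, the others are kept. -/
def completion (lam : PartFun F) : PartFun F :=
  lam.update (phiOne F) (IntPartition.completion (lam (phiOne F)))

end PartFun

/-- `lam` is the type of the square matrix `A`: the `F[t]`-module on which `t` acts as `A` is
isomorphic to the direct sum of the modules `F[t] / (f ^ i)`, for `f ∈ Φ` and `i` a part of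
`lam f`, counted with multiplicity. -/
def HasType {F : Type*} [Field F] {ι : Type*} [Fintype ι] [DecidableEq ι]
    (A : Matrix ι ι F) (lam : PartFun F) : Prop :=
  Nonempty (Module.AEval' (Matrix.toLin' A) ≃ₗ[F[X]]
    ⨁ f : Phi F, ⨁ i : (lam f).ToType, F[X] ⧸ Ideal.span {f.1 ^ (i.1 : ℕ)})

/-! ### Fixed space and reflection length -/

/-- The fixed space `V^A = ker (A - 1)` (left action on column vectors). -/
def fixedSpace {F : Type*} [Field F] {ι : Type*} [Fintype ι] [DecidableEq ι]
    (A : Matrix ι ι F) : Submodule F (ι → F) :=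
  LinearMap.ker (Matrix.toLin' (A - 1))

/-- A reflection of `GL`: an element whose residual space `(g - 1) V` is one-dimensional. -/
def IsReflection {F : Type*} [Field F] {ι : Type*} [Fintype ι] [DecidableEq ι]
    (g : GL ι F) : Prop :=
  Module.finrank F (LinearMap.range (Matrix.toLin' ((g : Matrix ι ι F) - 1))) = 1

/-- The reflection length of `g` in `GL`: the least length of a factorization of `g` into
reflections. -/
def reflLength {F : Type*} [Field F] {ι : Type*} [Fintype ι] [DecidableEq ι]
    (g : GL ι F) : ℕ :=
  sInf {l | ∃ L : List (GL ι F), L.length = l ∧ (∀ r ∈ L, IsReflection r) ∧ L.prod = g}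

/-! ### The symplectic groups and their embeddings -/

/-- The group `Sp_n` of symplectic `2n × 2n` matrices. The index `Sum.inl i` stands for the
basis vector `e_i`, and `Sum.inr i` for its hyperbolic conjugate `f_i`. -/
abbrev Sp (n : ℕ) (F : Type*) [Field F] : Submonoid (Matrix (Fin n ⊕ Fin n) (Fin n ⊕ Fin n) F) :=
  Matrix.symplecticGroup (Fin n) F

/-- The inclusion of `Sp_n` into `GL_{2n}`. -/
def spToGL {n : ℕ} {F : Type*} [Field F] : Sp n F →* GL (Fin n ⊕ Fin n) F :=
  (Units.map (Sp n F).subtype).comp (toUnits (G := Sp n F)).toMonoidHom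

/-- The reflection length of a symplectic matrix, taken in `GL_{2n}`. -/
def rl {n : ℕ} {F : Type*} [Field F] (U : Sp n F) : ℕ := reflLength (spToGL U)

/-- The splitting of the hyperbolic basis `e_1, …, e_n, f_1, …, f_n` into the first `m` and the
last `n - m` hyperbolic pairs. -/
def splitIndex {m n : ℕ} (h : m ≤ n) :
    (Fin m ⊕ Fin m) ⊕ (Fin (n - m) ⊕ Fin (n - m)) ≃ Fin n ⊕ Fin n :=
  (Equiv.sumSumSumComm (Fin m) (Fin m) (Fin (n - m)) (Fin (n - m))).trans
    (Equiv.sumCongr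
      (finSumFinEquiv.trans (finCongr (Nat.add_sub_of_le h)))
      (finSumFinEquiv.trans (finCongr (Nat.add_sub_of_le h))))

/-- The matrix of size `2n` with the given block form with respect to the splitting
`V_n = V_m ⊥ V_{m,n}`. -/
def ofBlocks {F : Type*} {m n : ℕ} (h : m ≤ n)
    (A : Matrix (Fin m ⊕ Fin m) (Fin m ⊕ Fin m) F)
    (B : Matrix (Fin m ⊕ Fin m) (Fin (n - m) ⊕ Fin (n - m)) F)
    (C : Matrix (Fin (n - m) ⊕ Fin (n - m)) (Fin m ⊕ Fin m) F)
    (D : Matrix (Fin (n - m) ⊕ Fin (n - m)) (Fin (n - m) ⊕ Fin (n - m)) F) :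
    Matrix (Fin n ⊕ Fin n) (Fin n ⊕ Fin n) F :=
  Matrix.reindex (splitIndex h) (splitIndex h) (Matrix.fromBlocks A B C D)

theorem J_eq_ofBlocks {F : Type*} [Field F] {m n : ℕ} (h : m ≤ n) :
    Matrix.J (Fin n) F =
      ofBlocks h (Matrix.J (Fin m) F) 0 0 (Matrix.J (Fin (n - m)) F) := by
  rw [ofBlocks, ← Equiv.symm_apply_eq]
  ext i j
  rcases i with (i | i) | (i | i) <;> rcases j with (j | j) | (j | j) <;>
    simp [Matrix.J, splitIndex, Matrix.fromBlocks, Matrix.one_apply, Fin.ext_iff] <;> omega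

theorem ofBlocks_mem_Sp {F : Type*} [Field F] {m n : ℕ} (h : m ≤ n) (U : Sp m F) :
    ofBlocks h (U : Matrix (Fin m ⊕ Fin m) (Fin m ⊕ Fin m) F) 0 0 1 ∈ Sp n F := by
  have hU := SymplecticGroup.mem_iff.1 U.2
  rw [SymplecticGroup.mem_iff, J_eq_ofBlocks h]
  simp only [ofBlocks, Matrix.reindex_apply, Matrix.transpose_submatrix,
    Matrix.submatrix_mul_equiv, Matrix.fromBlocks_transpose, Matrix.fromBlocks_multiply]
  simp [hU]

/-- The embedding `U ↦ U^{↑↑n} = diag(U, 1)` of `Sp_m` into `Sp_n`, for `m ≤ n`. -/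
def upup {F : Type*} [Field F] {m n : ℕ} (h : m ≤ n) (U : Sp m F) : Sp n F :=
  ⟨ofBlocks h U 0 0 1, ofBlocks_mem_Sp h U⟩

/-! ### Block description of centralizers -/

/-- The matrix of the symplectic form `Q`, with `Q(e_i, f_i) = 1`. Thus `Aᵀ * formQ * B` is the
matrix of the values `Q(C_u(A), C_v(B))` at the columns of `A` and of `B`. -/
def formQ (n : ℕ) (F : Type*) [Field F] : Matrix (Fin n ⊕ Fin n) (Fin n ⊕ Fin n) F :=
  Matrix.fromBlocks 0 1 (-1) 0

section Blocks

variable {F : Type*} [Field F] {m n : ℕ}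

/-- `P` is a set of pivotal basis elements for `U`: the standard basis vectors with index in `P`
form a basis of the fixed space `V^U`. The corresponding leading basis elements are the
hyperbolic conjugates `a'` (`a.swap` in the code) of the elements `a` of `P`. -/
def IsPivotal (U : Sp m F) (P : Finset (Fin m ⊕ Fin m)) : Prop :=
  fixedSpace (U : Matrix (Fin m ⊕ Fin m) (Fin m ⊕ Fin m) F) =
    Submodule.span F ((fun a => Pi.single a (1 : F)) '' (P : Set (Fin m ⊕ Fin m)))

variable (P : Finset (Fin m ⊕ Fin m))

/-- The leading submatrix: rows and columns `a'`, for `a ∈ P`. -/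
def leadSub (M : Matrix (Fin m ⊕ Fin m) (Fin m ⊕ Fin m) F) : Matrix P P F :=
  M.submatrix (fun a => a.1.swap) (fun a => a.1.swap)

/-- The signs `σ = diag(Q(a', a))`, for `a ∈ P`. -/
def sigmaMat (F : Type*) [Field F] (P : Finset (Fin m ⊕ Fin m)) : Matrix P P F :=
  Matrix.diagonal fun a => formQ m F a.1.swap a.1

/-- The matrix of size `2m` whose entry at `(a, b')` is `A a b` for `a, b ∈ P`, and whose other
entries vanish. -/
def overlineMat (A : Matrix P P F) : Matrix (Fin m ⊕ Fin m) (Fin m ⊕ Fin m) F :=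
  Matrix.of fun u v => if h : u ∈ P ∧ v.swap ∈ P then A ⟨u, h.1⟩ ⟨v.swap, h.2⟩ else 0

/-- The set of all matrices of size `2n` with blocks `M₁₁, M₁₂, M₂₁, M₂₂` such that
* `M₂₂` is symplectic, `U M₁₂ = M₁₂` and `M₂₁ U = M₂₁`;
* the pivotal rows of `M₁₂` are `-(leadᵀ σ)⁻¹ (Q(C_{a'}(M₂₁), C_v(M₂₂)))`;
* `M₁₁` plus one half of `(leadᵀ σ)⁻¹ (Q(C_{a'}(M₂₁), C_{b'}(M₂₁)))`, placed at the positions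
  `(a, b')`, lies in the given subgroup `C` of `Sp_m`. -/
def blockSet (h : m ≤ n) (U : Sp m F) (C : Subgroup (Sp m F)) :
    Set (Matrix (Fin n ⊕ Fin n) (Fin n ⊕ Fin n) F) :=
  {M | ∃ M₁₁ M₁₂ M₂₁ M₂₂, M = ofBlocks h M₁₁ M₁₂ M₂₁ M₂₂ ∧
    M₂₂ ∈ Sp (n - m) F ∧
    (U : Matrix (Fin m ⊕ Fin m) (Fin m ⊕ Fin m) F) * M₁₂ = M₁₂ ∧
    M₂₁ * (U : Matrix (Fin m ⊕ Fin m) (Fin m ⊕ Fin m) F) = M₂₁ ∧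
    M₁₂.submatrix (fun a : P => a.1) id =
      -(((leadSub P M₁₁).transpose * sigmaMat F P)⁻¹ *
        (M₂₁.transpose * formQ (n - m) F * M₂₂).submatrix (fun a : P => a.1.swap) id) ∧
    ∃ D ∈ C, M₁₁ + overlineMat P ((2 : F)⁻¹ •
      (((leadSub P M₁₁).transpose * sigmaMat F P)⁻¹ *
        (M₂₁.transpose * formQ (n - m) F * M₂₁).submatrix
          (fun a : P => a.1.swap) (fun b : P => b.1.swap))) =
      (D : Matrix (Fin m ⊕ Fin m) (Fin m ⊕ Fin m) F)}

end Blocks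

end

/-!
Write `W` for the fixed space of `U` and `Q` for the symplectic form. The range of `U - 1` is
orthogonal to `W`, as `U` is an isometry. If the Jordan form of `U` has no identity block, then
every primary component of the module given by `U` is one on which `t - 1` is invertible or of the
form `F[t] / (t - 1) ^ i` with `i ≥ 2`; hence `W ≤ range (U - 1)` (`HasType.exists_sub_eq`), and
`W` is isotropic.

A matrix `M` with blocks `A, B, N, D` commutes with `diag(U, 1)` if and only if `A` commutes with
`U`, the columns of `B` lie in `W`, and `N` vanishes on `range (U - 1)`, the orthogonal complement
of `W`. Since `W` is isotropic, `M` is then an isometry if and only if `D` is one,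
`Q(A x, B y) + Q(N x, D y) = 0` and `Q(A x, A y) + Q(N x, N y) = Q(x, y)`. As `A` commutes
with `U`, it preserves `W` and `range (U - 1)`; it acts invertibly on the quotient by
`range (U - 1)`, and `leadSub` is the matrix of this action (`IsPivotal.isUnit_det_leadSub`). So
the first equation can be solved uniquely for `B` (`IsPivotal.mixed_block_iff`). For the second one
there is a unique `E` with range in `W`, zero on `range (U - 1)`, such that
`Q(A x, E y) = Q(N x, N y) / 2`, and the equation says exactly that `A + E` is an isometry
(`IsPivotal.add_overlineMat_mem_Sp_iff`); moreover `A + E` commutes with `U` if and only if `A`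
does. This is the block description (`image_centralizer_eq_blockSet`), and `A + E`, `D` and `N` are
free parameters, which gives the order (`IsPivotal.card_blockSet`).

For a pair `U₁, U₂` the same argument applies as soon as both fix `W`, the fixed space of
`U₁ * U₂`; a single element is the pair `U, 1`. The reflection length of `g` is the rank of `g - 1`
(`reflLength_eq_rank`), so that additivity of the reflection length forces, by comparing
dimensions, the fixed space of `U₁ * U₂` to be the intersection of those of `U₁` and `U₂`
(`fixedSpace_mul_le_of_rank_add`). Finally, an isotropic subspace is spanned by part of some
hyperbolic basis, so that after conjugation `W` is spanned by basis vectors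
(`exists_isPivotal_conj`).
-/

open Matrix

/-! ### Modules of a given type -/

section TypeModule

variable {F : Type*} [Field F]

/-- Modification followed by completion deletes exactly the parts equal to `1`. -/
theorem IntPartition.weight_completion_modification (p : IntPartition) :
    IntPartition.weight p.modification.completion + p.count 1 = IntPartition.weight p := by
  induction p using Multiset.induction_on with
  | empty => rfl
  | cons k p ih =>
    simp only [weight, completion, modification] at ih ⊢
    by_cases hk : 1 < k
    · have h1 : ((k - 1 + 1 : ℕ+) : ℕ) = k := by rw [PNat.sub_add_of_lt hk]
      rw [Multiset.filterMap_cons_some _ k _ (b := k - 1) (by rw [if_pos hk]), Multiset.map_cons,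
        Multiset.map_cons, Multiset.sum_cons, h1, Multiset.count_cons_of_ne hk.ne,
        Multiset.map_cons, Multiset.sum_cons]
      omega
    · have h1 : k = 1 := le_antisymm (not_lt.1 hk) (one_le)
      subst h1
      rw [Multiset.filterMap_cons_none _ _ (by rw [if_neg hk]), Multiset.count_cons_self,
        Multiset.map_cons, Multiset.sum_cons, PNat.one_coe]
      omega

theorem PartFun.weight_completion_modification (lam : PartFun F) :
    lam.modification.completion.weight + (lam (phiOne F)).count 1 = lam.weight := by
  classical
  have hdeg : (phiOne F).1.natDegree = 1 := Polynomial.natDegree_X_sub_C 1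
  have h0 : ∀ f : Phi F, f.1.natDegree * IntPartition.weight 0 = 0 := fun f => by
    simp [IntPartition.weight]
  have hadd : ∀ (f : Phi F) (p q : IntPartition), f.1.natDegree * IntPartition.weight (p + q) =
      f.1.natDegree * IntPartition.weight p + f.1.natDegree * IntPartition.weight q := by
    intro f p q
    rw [IntPartition.weight, Multiset.map_add, Multiset.sum_add, mul_add]
    rfl
  have h1 := Finsupp.sum_update_add lam (phiOne F)
    (IntPartition.modification (lam (phiOne F)))
    (fun f p => f.1.natDegree * IntPartition.weight p) h0 hadd
  have h2 := Finsupp.sum_update_add lam.modification (phiOne F)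
    (IntPartition.completion (lam.modification (phiOne F)))
    (fun f p => f.1.natDegree * IntPartition.weight p) h0 hadd
  have h3 : lam.modification (phiOne F) = IntPartition.modification (lam (phiOne F)) := by
    simp [PartFun.modification]
  have h4 := IntPartition.weight_completion_modification (lam (phiOne F))
  rw [h3, hdeg] at h2
  rw [hdeg] at h1
  have e1 : lam.weight = lam.sum fun f p => f.1.natDegree * IntPartition.weight p := rfl
  have e2 : lam.modification.weight = (lam.update (phiOne F)
    (IntPartition.modification (lam (phiOne F)))).sum fun f p =>
      f.1.natDegree * IntPartition.weight p := rfl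
  have e3 : lam.modification.completion.weight = (lam.modification.update (phiOne F)
    (IntPartition.completion (IntPartition.modification (lam (phiOne F))))).sum fun f p =>
      f.1.natDegree * IntPartition.weight p := by
    rw [← h3]
    rfl
  have e4 : lam.modification.weight = lam.modification.sum fun f p =>
      f.1.natDegree * IntPartition.weight p := rfl
  omega

/-- The `F[t]`-module with the given type. -/
abbrev TypeModule (lam : PartFun F) : Type _ :=
  ⨁ f : Phi F, ⨁ i : (lam f).ToType, F[X] ⧸ Ideal.span {f.1 ^ (i.1 : ℕ)}

theorem finrank_primary_component (f : Phi F) (p : IntPartition) :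
    Module.finrank F (⨁ i : p.ToType, F[X] ⧸ Ideal.span {f.1 ^ (i.1 : ℕ)}) =
      f.1.natDegree * IntPartition.weight p := by
  classical
  have hf : ∀ k : ℕ, f.1 ^ k ≠ 0 := fun k => (f.2.1.pow k).ne_zero
  have : ∀ i : p.ToType, Module.Finite F (F[X] ⧸ Ideal.span {f.1 ^ (i.1 : ℕ)}) := fun i =>
    (f.2.1.pow _).finite_quotient
  rw [Module.finrank_directSum]
  simp only [finrank_quotient_span_eq_natDegree, Polynomial.natDegree_pow]
  rw [← Finset.sum_mul, mul_comm, IntPartition.weight]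
  congr 1
  rw [Finset.sum_eq_multiset_sum]
  exact congrArg Multiset.sum (Multiset.map_univ p fun k : ℕ+ => (k : ℕ))

/-- The weight of a type is at most the dimension of the module: the direct sum over the finite
support of the type is a quotient of the direct sum over all of `Φ`. -/
theorem weight_le_finrank (lam : PartFun F) [Module.Finite F (TypeModule lam)] :
    lam.weight ≤ Module.finrank F (TypeModule lam) := by
  classical
  have hfin : ∀ (f : Phi F), Module.Finite F
      (⨁ i : (lam f).ToType, F[X] ⧸ Ideal.span {f.1 ^ (i.1 : ℕ)}) := fun f => by
    have : ∀ i : (lam f).ToType, Module.Finite F (F[X] ⧸ Ideal.span {f.1 ^ (i.1 : ℕ)}) :=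
      fun i => (f.2.1.pow _).finite_quotient
    infer_instance
  let φ : TypeModule lam →ₗ[F] ⨁ f : {f // f ∈ lam.support},
      ⨁ i : (lam f.1).ToType, F[X] ⧸ Ideal.span {f.1.1 ^ (i.1 : ℕ)} :=
    DFinsupp.subtypeDomainLinearMap F _ (fun f => f ∈ lam.support)
  have hφ : Function.Surjective φ := by
    intro x
    let y : TypeModule lam := DFinsupp.mk lam.support fun f => x f
    refine ⟨y, DFinsupp.ext fun f => ?_⟩
    change y f.1 = x f
    exact (DFinsupp.mk_apply ..).trans (dif_pos f.2)
  refine le_trans (le_of_eq ?_) (LinearMap.finrank_le_finrank_of_surjective hφ)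
  rw [Module.finrank_directSum]
  simp only [finrank_primary_component]
  exact (Finset.sum_coe_sort lam.support
    fun f => f.1.natDegree * IntPartition.weight (lam f)).symm

/-- If in every summand the elements killed by `r` are divisible by `r`, then the same holds in the
direct sum. -/
theorem DirectSum.exists_smul_eq {R ι : Type*} [CommRing R] {M : ι → Type*}
    [∀ i, AddCommGroup (M i)] [∀ i, Module R (M i)] (r : R)
    (h : ∀ i (x : M i), r • x = 0 → ∃ z, r • z = x) (x : ⨁ i, M i) (hx : r • x = 0) :
    ∃ z : ⨁ i, M i, r • z = x := by
  classical
  choose! g hg using h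
  have hxi : ∀ i, r • x i = 0 := fun i => by
    rw [← DirectSum.smul_apply, hx, DirectSum.zero_apply]
  refine ⟨DFinsupp.mapRange (fun i y => if y = 0 then 0 else g i y) (fun i => if_pos rfl) x, ?_⟩
  refine DFinsupp.ext fun i => ?_
  change r • (DFinsupp.mapRange _ _ x) i = x i
  rw [DFinsupp.mapRange_apply]
  split_ifs with h0
  · rw [smul_zero, h0]
  · exact hg i _ (hxi i)

/-- In `F[t] / (f ^ k)` the elements killed by `t - 1` are divisible by `t - 1`, unless the module
is `F[t] / (t - 1)`: for `f ≠ t - 1` there are none but zero, and for `f = t - 1` they are the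
multiples of `(t - 1) ^ (k - 1)`. -/
theorem exists_smul_eq_of_quotient (f : Phi F) (k : ℕ+) (hk : f = phiOne F → k ≠ 1)
    (x : F[X] ⧸ Ideal.span {f.1 ^ (k : ℕ)}) (hx : (phiOne F).1 • x = 0) :
    ∃ z, (phiOne F).1 • z = x := by
  by_cases hf : f = phiOne F
  · subst hf
    obtain ⟨p, rfl⟩ := Ideal.Quotient.mk_surjective x
    obtain ⟨j, hj⟩ : ∃ j, (k : ℕ) = j + 2 := by
      have h1 : (k : ℕ) ≠ 1 := fun h => hk rfl (PNat.coe_eq_one_iff.1 h)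
      have h2 := k.pos
      exact ⟨k - 2, by omega⟩
    have h3 : (phiOne F).1 ^ (k : ℕ) ∣ (phiOne F).1 * p := by
      rw [← Ideal.mem_span_singleton, ← Ideal.Quotient.eq_zero_iff_mem]
      exact hx
    rw [hj, show j + 2 = 1 + (j + 1) from by ring, pow_add, pow_one] at h3
    have h4 := (mul_dvd_mul_iff_left (phiOne F).2.1.ne_zero).1 h3
    obtain ⟨r, rfl⟩ := (dvd_pow_self _ (Nat.succ_ne_zero j)).trans h4
    exact ⟨Ideal.Quotient.mk _ r, rfl⟩
  · have hcop : IsCoprime (phiOne F).1 (f.1 ^ (k : ℕ)) := by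
      refine IsCoprime.pow_right ?_
      rw [(phiOne F).2.2.1.coprime_iff_not_dvd]
      intro hdvd
      refine hf (Subtype.ext ?_)
      exact (Polynomial.eq_of_monic_of_associated (phiOne F).2.1 f.2.1
        ((phiOne F).2.2.1.associated_of_dvd f.2.2.1 hdvd)).symm
    obtain ⟨a, b, hab⟩ := hcop
    obtain ⟨p, rfl⟩ := Ideal.Quotient.mk_surjective x
    refine ⟨0, ?_⟩
    rw [smul_zero]
    have h1 : (Ideal.Quotient.mk (Ideal.span {f.1 ^ (k : ℕ)})) ((phiOne F).1 * p) = 0 := hx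
    symm
    have h2 : p = a * ((phiOne F).1 * p) + b * p * f.1 ^ (k : ℕ) := by
      linear_combination (-p) * hab
    rw [h2, map_add, map_mul, h1, mul_zero, zero_add, Ideal.Quotient.eq_zero_iff_mem,
      Ideal.mem_span_singleton]
    exact dvd_mul_left _ _

/-- If `t - 1` has no part equal to `1`, every element killed by `t - 1` is divisible by
`t - 1`. -/
theorem TypeModule.exists_smul_eq {lam : PartFun F} (hcount : (lam (phiOne F)).count 1 = 0)
    (x : TypeModule lam) (hx : (phiOne F).1 • x = 0) :
    ∃ z : TypeModule lam, (phiOne F).1 • z = x := by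
  refine DirectSum.exists_smul_eq
    (M := fun f : Phi F => ⨁ i : (lam f).ToType, F[X] ⧸ Ideal.span {f.1 ^ (i.1 : ℕ)})
    (phiOne F).1 (fun f => ?_) x hx
  refine DirectSum.exists_smul_eq
    (M := fun i : (lam f).ToType => F[X] ⧸ Ideal.span {f.1 ^ (i.1 : ℕ)})
    (phiOne F).1 fun i => exists_smul_eq_of_quotient f i.1 ?_
  rintro rfl h1
  have hmem : i.1 ∈ lam (phiOne F) := Multiset.coe_mem
  rw [h1] at hmem
  exact Multiset.count_eq_zero.1 hcount hmem

section

variable {ι : Type*} [Fintype ι] [DecidableEq ι] {A : Matrix ι ι F} {lam : PartFun F}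

theorem HasType.count_one_eq_zero (hlam : HasType A lam)
    (hweight : lam.modification.completion.weight = Fintype.card ι) :
    (lam (phiOne F)).count 1 = 0 := by
  obtain ⟨e⟩ := hlam
  have h1 := lam.weight_completion_modification
  have e' : (ι → F) ≃ₗ[F] TypeModule lam :=
    (Module.AEval'.of (Matrix.toLin' A)).trans (e.restrictScalars F)
  have : Module.Finite F (TypeModule lam) := Module.Finite.equiv e'
  have h2 := weight_le_finrank lam
  rw [← e'.finrank_eq, Module.finrank_fintype_fun_eq_card] at h2
  omega

theorem phiOne_smul_of (A : Matrix ι ι F) (x : ι → F) :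
    (phiOne F).1 • Module.AEval'.of (Matrix.toLin' A) x =
      Module.AEval'.of (Matrix.toLin' A) (A *ᵥ x - x) := by
  have h : (phiOne F).1 = Polynomial.X - 1 := by simp [phiOne]
  rw [h, sub_smul, Module.AEval'.X_smul_of, one_smul, map_sub, toLin'_apply]

/-- If the Jordan form of `A` has no identity block, then every fixed vector lies in the range
of `A - 1`. -/
theorem HasType.exists_sub_eq (hlam : HasType A lam)
    (hweight : lam.modification.completion.weight = Fintype.card ι) {v : ι → F}
    (hv : A *ᵥ v = v) : ∃ z, A *ᵥ z - z = v := by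
  have hcount := hlam.count_one_eq_zero hweight
  obtain ⟨e⟩ := hlam
  have hx : (phiOne F).1 • e (Module.AEval'.of (Matrix.toLin' A) v) = 0 := by
    rw [← map_smul, phiOne_smul_of, hv, sub_self, map_zero, map_zero]
  obtain ⟨z, hz⟩ := TypeModule.exists_smul_eq hcount _ hx
  obtain ⟨y, hy⟩ := (Module.AEval'.of (Matrix.toLin' A)).surjective (e.symm z)
  refine ⟨y, (Module.AEval'.of (Matrix.toLin' A)).injective ?_⟩
  rw [← phiOne_smul_of, hy, ← map_smul, hz, LinearEquiv.symm_apply_apply]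

end

end TypeModule

/-! ### Reflection length -/

theorem rank_add_le_rank_add_rank {F : Type*} [Field F] {ι : Type*} [Fintype ι]
    (A B : Matrix ι ι F) :
    (A + B).rank ≤ A.rank + B.rank := by
  rw [rank, mulVecLin_add]
  exact (Submodule.finrank_mono (LinearMap.range_add_le _ _)).trans
    (Submodule.finrank_add_le_finrank_add_finrank _ _)

section ReflectionLength

variable {F : Type*} [Field F] {ι : Type*} [Fintype ι] [DecidableEq ι]

theorem finrank_range_toLin' (A : Matrix ι ι F) :
    Module.finrank F (LinearMap.range (toLin' A)) = A.rank := rfl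

theorem finrank_fixedSpace_add_rank (A : Matrix ι ι F) :
    Module.finrank F (fixedSpace A) + (A - 1).rank = Fintype.card ι := by
  have h := LinearMap.finrank_range_add_finrank_ker (toLin' (A - 1))
  rw [finrank_range_toLin', Module.finrank_fintype_fun_eq_card] at h
  rw [fixedSpace, add_comm]
  exact h

theorem rank_mul_sub_one_le (A B : Matrix ι ι F) :
    (A * B - 1).rank ≤ (A - 1).rank + (B - 1).rank := by
  have h : A * B - 1 = (A - 1) * B + (B - 1) := by
    rw [Matrix.sub_mul, Matrix.one_mul]
    abel
  rw [h]
  exact (rank_add_le_rank_add_rank _ _).trans (Nat.add_le_add_right (rank_mul_le_left _ _) _)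

theorem rank_sub_one_le_length (L : List (GL ι F)) (hL : ∀ r ∈ L, IsReflection r) :
    ((L.prod : GL ι F).val - 1).rank ≤ L.length := by
  induction L with
  | nil => simp
  | cons r L ih =>
    have hr : (r.val - 1).rank = 1 := hL r (by simp)
    have h1 := ih fun s hs => hL s (by simp [hs])
    rw [List.prod_cons, List.length_cons, Units.val_mul]
    have := rank_mul_sub_one_le r.val (L.prod : GL ι F).val
    omega

/-- Two nonzero vectors admit a functional that vanishes at neither of them. -/
theorem exists_dotProduct_ne_zero {x y : ι → F} (hx : x ≠ 0) (hy : y ≠ 0) :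
    ∃ c : ι → F, c ⬝ᵥ x ≠ 0 ∧ c ⬝ᵥ y ≠ 0 := by
  obtain ⟨i, hi⟩ := Function.ne_iff.1 hx
  obtain ⟨j, hj⟩ := Function.ne_iff.1 hy
  by_cases hyi : y i = 0
  · by_cases hxj : x j = 0
    · refine ⟨Pi.single i 1 + Pi.single j 1, ?_, ?_⟩
      · simpa [add_dotProduct, hxj] using hi
      · simpa [add_dotProduct, hyi] using hj
    · exact ⟨Pi.single j 1, by simpa using hxj, by simpa using hj⟩
  · exact ⟨Pi.single i 1, by simpa using hi, by simpa using hyi⟩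

/-- The reflection that maps `v` to `w` and fixes the hyperplane `c = 0`. -/
noncomputable def reflectionTo (c v w : ι → F) (hv : c ⬝ᵥ v ≠ 0) (hw : c ⬝ᵥ w ≠ 0) : GL ι F where
  val := 1 + vecMulVec ((c ⬝ᵥ v)⁻¹ • (w - v)) c
  inv := 1 + vecMulVec ((c ⬝ᵥ w)⁻¹ • (v - w)) c
  val_inv := by
    rw [Matrix.add_mul, Matrix.one_mul, Matrix.mul_add, Matrix.mul_one,
      vecMulVec_mul_vecMulVec]
    ext i j
    simp only [Matrix.add_apply, vecMulVec_apply, Pi.smul_apply, Pi.sub_apply, smul_eq_mul,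
      dotProduct_smul, dotProduct_sub]
    field_simp
    ring
  inv_val := by
    rw [Matrix.add_mul, Matrix.one_mul, Matrix.mul_add, Matrix.mul_one,
      vecMulVec_mul_vecMulVec]
    ext i j
    simp only [Matrix.add_apply, vecMulVec_apply, Pi.smul_apply, Pi.sub_apply, smul_eq_mul,
      dotProduct_smul, dotProduct_sub]
    field_simp
    ring

theorem reflectionTo_mulVec (c v w : ι → F) (hv : c ⬝ᵥ v ≠ 0) (hw : c ⬝ᵥ w ≠ 0) (x : ι → F) :
    (reflectionTo c v w hv hw).val *ᵥ x = x + ((c ⬝ᵥ v)⁻¹ * (c ⬝ᵥ x)) • (w - v) := by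
  rw [reflectionTo, add_mulVec, one_mulVec, vecMulVec_mulVec]
  ext i
  simp
  ring

theorem isReflection_reflectionTo (c v w : ι → F) (hv : c ⬝ᵥ v ≠ 0) (hw : c ⬝ᵥ w ≠ 0)
    (hvw : v ≠ w) : IsReflection (reflectionTo c v w hv hw) := by
  rw [IsReflection, finrank_range_toLin', reflectionTo]
  simp only [add_sub_cancel_left]
  refine le_antisymm (rank_vecMulVec_le _ _) (Nat.one_le_iff_ne_zero.2 fun h => ?_)
  have h0 : vecMulVec ((c ⬝ᵥ v)⁻¹ • (w - v)) c = 0 := by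
    rw [rank, Submodule.finrank_eq_zero, LinearMap.range_eq_bot] at h
    rwa [← Matrix.toLin'_apply', LinearEquiv.map_eq_zero_iff] at h
  have h1 := congrArg (fun X => X *ᵥ v) h0
  simp only [vecMulVec_mulVec, zero_mulVec] at h1
  have h2 : w - v = 0 := by
    have h3 : (c ⬝ᵥ v) • ((c ⬝ᵥ v)⁻¹ • (w - v)) = 0 := by simpa using h1
    rwa [smul_smul, mul_inv_cancel₀ hv, one_smul] at h3
  exact hvw (sub_eq_zero.1 h2).symm

/-- If `A v ≠ v`, there is a reflection `r` with `r v = A v` that fixes the fixed space of `A`;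
then `r⁻¹ A` has a larger fixed space than `A`. This gives a factorization with
`rank (A - 1)` factors. -/
theorem exists_reflection_factorization (A : GL ι F) :
    ∃ L : List (GL ι F), L.length ≤ (A.val - 1).rank ∧ (∀ r ∈ L, IsReflection r) ∧
      L.prod = A := by
  induction hk : (A.val - 1).rank using Nat.strong_induction_on generalizing A with
  | _ k ih =>
    by_cases h1 : A = 1
    · exact ⟨[], by simp, by simp, by simp [h1]⟩
    obtain ⟨v, hv⟩ : ∃ v, A.val *ᵥ v ≠ v := by
      by_contra! h
      refine h1 (Units.ext (ext_of_mulVec_single fun i => ?_))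
      rw [h, Units.val_one, one_mulVec]
    have hx : A.val *ᵥ v - v ≠ 0 := sub_ne_zero.2 hv
    have hinj : Function.Injective (A.val *ᵥ ·) := mulVec_injective_of_isUnit A.isUnit
    have hy : A.val *ᵥ (A.val *ᵥ v - v) ≠ 0 := by
      intro h
      exact hx (hinj (by simpa using h))
    obtain ⟨c₀, hc1, hc2⟩ := exists_dotProduct_ne_zero hx hy
    -- the functional `c = c₀ (A - 1)` vanishes on the fixed space of `A`
    set c := c₀ ᵥ* (A.val - 1) with hc
    have hcx : ∀ x, c ⬝ᵥ x = c₀ ⬝ᵥ (A.val *ᵥ x - x) := by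
      intro x
      rw [hc, ← dotProduct_mulVec, sub_mulVec, one_mulVec]
    have hcv : c ⬝ᵥ v ≠ 0 := by rwa [hcx]
    have hcw : c ⬝ᵥ (A.val *ᵥ v) ≠ 0 := by rwa [hcx, ← mulVec_sub]
    set r := reflectionTo c v (A.val *ᵥ v) hcv hcw with hr
    have hrv : r.val *ᵥ v = A.val *ᵥ v := by
      rw [hr, reflectionTo_mulVec, inv_mul_cancel₀ hcv]
      simp
    have hrfix : ∀ x, A.val *ᵥ x = x → r.val *ᵥ x = x := by
      intro x hxx
      rw [hr, reflectionTo_mulVec, hcx x, hxx]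
      simp
    have hinv : ∀ x y, r.val *ᵥ x = y → (r⁻¹ : GL ι F).val *ᵥ y = x := by
      rintro x y rfl
      rw [mulVec_mulVec, ← Units.val_mul, inv_mul_cancel]
      simp
    have hlt : fixedSpace A.val < fixedSpace (r⁻¹ * A).val := by
      refine lt_of_le_of_ne (fun x hxA => ?_) fun heq => ?_
      · rw [fixedSpace, LinearMap.mem_ker, toLin'_apply, sub_mulVec, one_mulVec, sub_eq_zero]
          at hxA ⊢
        rw [Units.val_mul, ← mulVec_mulVec, hxA]
        exact hinv _ _ (hrfix x hxA)
      · have hmem : v ∈ fixedSpace (r⁻¹ * A).val := by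
          rw [fixedSpace, LinearMap.mem_ker, toLin'_apply, sub_mulVec, one_mulVec, sub_eq_zero,
            Units.val_mul, ← mulVec_mulVec]
          exact hinv _ _ hrv
        rw [← heq, fixedSpace, LinearMap.mem_ker, toLin'_apply, sub_mulVec, one_mulVec] at hmem
        exact hx hmem
    have hfin := Submodule.finrank_lt_finrank_of_lt hlt
    have hd1 := finrank_fixedSpace_add_rank A.val
    have hd2 := finrank_fixedSpace_add_rank (r⁻¹ * A).val
    obtain ⟨L, hL1, hL2, hL3⟩ := ih _ (by omega) (r⁻¹ * A) rfl
    refine ⟨r :: L, ?_, ?_, ?_⟩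
    · rw [List.length_cons]
      omega
    · intro s hs
      rcases List.mem_cons.1 hs with h | hs
      · exact h ▸ isReflection_reflectionTo _ _ _ _ _ hv.symm
      · exact hL2 s hs
    · rw [List.prod_cons, hL3, mul_inv_cancel_left]

/-- The reflection length is the codimension of the fixed space. -/
theorem reflLength_eq_rank (A : GL ι F) : reflLength A = (A.val - 1).rank := by
  obtain ⟨L, hL1, hL2, hL3⟩ := exists_reflection_factorization A
  have hmem : L.length ∈ {l | ∃ L : List (GL ι F),
      L.length = l ∧ (∀ r ∈ L, IsReflection r) ∧ L.prod = A} := ⟨L, rfl, hL2, hL3⟩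
  refine le_antisymm ((Nat.sInf_le hmem).trans hL1) ?_
  obtain ⟨L', hL1', hL2', hL3'⟩ := Nat.sInf_mem ⟨_, hmem⟩
  rw [reflLength, ← hL1', ← hL3']
  exact rank_sub_one_le_length L' hL2'

/-- If the reflection length is additive on `A * B`, then the fixed space of `A * B` is the
intersection of those of `A` and `B`. -/
theorem fixedSpace_mul_le_of_rank_add {A B : Matrix ι ι F}
    (h : (A - 1).rank + (B - 1).rank = (A * B - 1).rank) :
    fixedSpace (A * B) ≤ fixedSpace A ⊓ fixedSpace B := by
  have hle : fixedSpace A ⊓ fixedSpace B ≤ fixedSpace (A * B) := by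
    rintro x ⟨hA, hB⟩
    simp only [fixedSpace, SetLike.mem_coe, LinearMap.mem_ker, toLin'_apply, sub_mulVec,
      one_mulVec, sub_eq_zero, ← mulVec_mulVec] at hA hB ⊢
    rw [hB, hA]
  refine (Submodule.eq_of_le_of_finrank_le hle ?_).ge
  have h1 := Submodule.finrank_sup_add_finrank_inf_eq (fixedSpace A) (fixedSpace B)
  have h2 := Submodule.finrank_le (fixedSpace A ⊔ fixedSpace B)
  rw [Module.finrank_fintype_fun_eq_card] at h2
  have hA := finrank_fixedSpace_add_rank A
  have hB := finrank_fixedSpace_add_rank B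
  have hAB := finrank_fixedSpace_add_rank (A * B)
  omega

theorem rl_eq_rank {m : ℕ} (U : Sp m F) : rl U = (U.1 - 1).rank := by
  rw [rl, reflLength_eq_rank]
  rfl

end ReflectionLength

/-! ### The symplectic form and block matrices -/

section Centralizer

variable {F : Type*} [Field F] {m n : ℕ}

theorem formQ_eq_neg_J (n : ℕ) : formQ n F = -J (Fin n) F := by
  simp [formQ, J, fromBlocks_neg]

theorem mem_Sp_iff {A : Matrix (Fin n ⊕ Fin n) (Fin n ⊕ Fin n) F} :
    A ∈ Sp n F ↔ Aᵀ * formQ n F * A = formQ n F := by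
  rw [SymplecticGroup.mem_iff', formQ_eq_neg_J]
  simp

theorem formQ_transpose (n : ℕ) : (formQ n F)ᵀ = -formQ n F := by
  simp [formQ_eq_neg_J]

theorem formQ_apply_eq_zero {u v : Fin n ⊕ Fin n} (h : v ≠ u.swap) : formQ n F u v = 0 := by
  rcases u with u | u <;> rcases v with v | v <;> simp_all [formQ, one_apply, eq_comm]

theorem formQ_swap_ne_zero (u : Fin n ⊕ Fin n) : formQ n F u.swap u ≠ 0 := by
  rcases u with u | u <;> simp [formQ]

theorem transpose_mul_formQ_apply {κ : Type*} (A : Matrix (Fin n ⊕ Fin n) κ F) (u : κ)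
    (w : Fin n ⊕ Fin n) : (Aᵀ * formQ n F) u w = A w.swap u * formQ n F w.swap w := by
  rw [mul_apply, Finset.sum_eq_single w.swap]
  · rfl
  · intro b _ hb
    rw [formQ_apply_eq_zero, mul_zero]
    rintro rfl
    exact hb (by simp)
  · simp

theorem formQ_eq_ofBlocks (h : m ≤ n) :
    formQ n F = ofBlocks h (formQ m F) 0 0 (formQ (n - m) F) := by
  rw [formQ_eq_neg_J, J_eq_ofBlocks h, formQ_eq_neg_J, formQ_eq_neg_J, ofBlocks, ofBlocks,
    reindex_apply, reindex_apply, show fromBlocks (-J (Fin m) F) 0 0 (-J (Fin (n - m)) F) =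
      -fromBlocks (J (Fin m) F) 0 0 (J (Fin (n - m)) F) by simp [fromBlocks_neg]]
  rfl

theorem ofBlocks_mul (h : m ≤ n) (A B C D A' B' C' D') :
    ofBlocks (F := F) h A B C D * ofBlocks h A' B' C' D' =
      ofBlocks h (A * A' + B * C') (A * B' + B * D') (C * A' + D * C') (C * B' + D * D') := by
  simp only [ofBlocks, reindex_apply, submatrix_mul_equiv, fromBlocks_multiply]

theorem ofBlocks_transpose {R : Type*} (h : m ≤ n) (A B C D) :
    (ofBlocks (F := R) h A B C D)ᵀ = ofBlocks h Aᵀ Cᵀ Bᵀ Dᵀ := by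
  simp only [ofBlocks, reindex_apply, transpose_submatrix, fromBlocks_transpose]

theorem ofBlocks_inj {R : Type*} (h : m ≤ n) {A B C D A' B' C' D'} :
    ofBlocks (F := R) h A B C D = ofBlocks h A' B' C' D' ↔
      A = A' ∧ B = B' ∧ C = C' ∧ D = D' := by
  rw [ofBlocks, ofBlocks, (reindex _ _).injective.eq_iff, fromBlocks_inj]

theorem exists_eq_ofBlocks {R : Type*} (h : m ≤ n) (M : Matrix (Fin n ⊕ Fin n) (Fin n ⊕ Fin n) R) :
    ∃ A B C D, M = ofBlocks h A B C D :=
  let M' := (reindex (splitIndex h) (splitIndex h)).symm M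
  ⟨M'.toBlocks₁₁, M'.toBlocks₁₂, M'.toBlocks₂₁, M'.toBlocks₂₂, by
    rw [ofBlocks, fromBlocks_toBlocks, Equiv.apply_symm_apply]⟩

theorem ofBlocks_mem_Sp_iff (h : m ≤ n) {A B C D} :
    ofBlocks (F := F) h A B C D ∈ Sp n F ↔
      Aᵀ * formQ m F * A + Cᵀ * formQ (n - m) F * C = formQ m F ∧
      Aᵀ * formQ m F * B + Cᵀ * formQ (n - m) F * D = 0 ∧
      Bᵀ * formQ m F * B + Dᵀ * formQ (n - m) F * D = formQ (n - m) F := by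
  rw [mem_Sp_iff, formQ_eq_ofBlocks h, ofBlocks_transpose, ofBlocks_mul, ofBlocks_mul,
    ofBlocks_inj]
  simp only [Matrix.mul_zero, add_zero, zero_add]
  constructor
  · rintro ⟨h1, h2, -, h4⟩
    exact ⟨h1, h2, h4⟩
  · rintro ⟨h1, h2, h4⟩
    refine ⟨h1, h2, ?_, h4⟩
    have := congrArg transpose h2
    simp only [transpose_add, transpose_mul, transpose_transpose, formQ_transpose, transpose_zero,
      Matrix.mul_neg, Matrix.neg_mul, ← neg_add, neg_eq_zero, ← Matrix.mul_assoc] at this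
    exact this

theorem mem_centralizer_upup_iff (h : m ≤ n) (V : Sp m F) (M : Sp n F) {A B C D}
    (hM : M.1 = ofBlocks h A B C D) :
    M ∈ Subgroup.centralizer {upup h V} ↔
      V.1 * A = A * V.1 ∧ V.1 * B = B ∧
        C * V.1 = C := by
  rw [Subgroup.mem_centralizer_singleton_iff, ← Subtype.coe_inj, Submonoid.coe_mul,
    Submonoid.coe_mul, hM, upup, ofBlocks_mul, ofBlocks_mul, ofBlocks_inj]
  simp only [Matrix.mul_zero, add_zero, zero_add, Matrix.mul_one, Matrix.one_mul, Matrix.zero_mul,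
    and_true]
  constructor
  · rintro ⟨h1, h2, h3⟩
    exact ⟨h1.symm, h2.symm, h3⟩
  · rintro ⟨h1, h2, h3⟩
    exact ⟨h1.symm, h2.symm, h3⟩

theorem mem_centralizer_Sp_iff (V D : Sp m F) :
    D ∈ Subgroup.centralizer {V} ↔
      V.1 * D.1 = D.1 * V.1 := by
  rw [Subgroup.mem_centralizer_singleton_iff, ← Subtype.coe_inj, Submonoid.coe_mul,
    Submonoid.coe_mul, eq_comm]

/-! ### Fixed rows and columns -/

theorem mem_fixedSpace_iff {ι : Type*} [Fintype ι] [DecidableEq ι] {A : Matrix ι ι F}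
    {v : ι → F} : v ∈ fixedSpace A ↔ A *ᵥ v = v := by
  rw [fixedSpace, LinearMap.mem_ker, toLin'_apply, sub_mulVec, one_mulVec, sub_eq_zero]

theorem mul_eq_self_iff_col_mem_fixedSpace {ι κ : Type*} [Fintype ι] [DecidableEq ι]
    {A : Matrix ι ι F} {B : Matrix ι κ F} : A * B = B ↔ ∀ v, B.col v ∈ fixedSpace A := by
  simp only [mem_fixedSpace_iff, ← ext_iff, funext_iff]
  exact forall_comm

/-- A row vector `c` is fixed by the symplectic matrix `V` acting from the right if and only if
the column vector `formQ * cᵀ` dual to it is fixed by `V` acting from the left. -/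
theorem mul_Sp_eq_self_iff {κ : Type*} (V : Sp m F) (C : Matrix κ (Fin m ⊕ Fin m) F) :
    C * V.1 = C ↔ V.1 * (formQ m F * Cᵀ) = formQ m F * Cᵀ := by
  have hV : V.1 * formQ m F * V.1ᵀ = formQ m F := by
    rw [formQ_eq_neg_J]
    simpa using SymplecticGroup.mem_iff.1 V.2
  have hV' : V.1 * (V⁻¹ : Sp m F).1 = 1 := by
    rw [← Submonoid.coe_mul, mul_inv_cancel, Submonoid.coe_one]
  have hV'' : (V⁻¹ : Sp m F).1 * V.1 = 1 := by
    rw [← Submonoid.coe_mul, inv_mul_cancel, Submonoid.coe_one]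
  have hQ : formQ m F * formQ m F = -1 := by
    simp [formQ_eq_neg_J, J_squared]
  constructor
  · intro h
    have h1 := congrArg transpose h
    rw [transpose_mul] at h1
    calc V.1 * (formQ m F * Cᵀ)
        = V.1 * (formQ m F * (V.1ᵀ * Cᵀ)) := by rw [h1]
      _ = (V.1 * formQ m F * V.1ᵀ) * Cᵀ := by
          simp only [Matrix.mul_assoc]
      _ = _ := by rw [hV]
  · intro h
    have h1 : V.1 * (formQ m F * (V.1ᵀ * Cᵀ)) =
        V.1 * (formQ m F * Cᵀ) := by
      rw [h, ← Matrix.mul_assoc, ← Matrix.mul_assoc, hV]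
    have h2 := congrArg
      (fun X => formQ m F * ((V⁻¹ : Sp m F).1 * X)) h1
    simp only [← Matrix.mul_assoc (V⁻¹ : Sp m F).1 V.1, hV'',
      Matrix.one_mul] at h2
    rw [← Matrix.mul_assoc (formQ m F), ← Matrix.mul_assoc (formQ m F) (formQ m F) Cᵀ, hQ] at h2
    apply transpose_injective
    simpa using h2

section Pivotal

variable {U : Sp m F} {P : Finset (Fin m ⊕ Fin m)}

theorem mem_span_single_iff {ι : Type*} [Fintype ι] [DecidableEq ι] (P : Finset ι) (v : ι → F) :
    v ∈ Submodule.span F ((fun a => Pi.single a (1 : F)) '' (P : Set ι)) ↔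
      ∀ u ∉ P, v u = 0 := by
  constructor
  · intro h
    induction h using Submodule.span_induction with
    | mem x hx =>
      obtain ⟨a, ha, rfl⟩ := hx
      intro u hu
      exact Pi.single_eq_of_ne (by rintro rfl; exact hu ha) _
    | zero => simp
    | add x y _ _ hx hy =>
      intro u hu
      simp [hx u hu, hy u hu]
    | smul c x _ hx =>
      intro u hu
      simp [hx u hu]
  · intro h
    have : v = ∑ a ∈ P, v a • Pi.single a (1 : F) := by
      ext u
      simp only [Finset.sum_apply, Pi.smul_apply, Pi.single_apply, smul_eq_mul, mul_ite, mul_one,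
        mul_zero, Finset.sum_ite_eq]
      split_ifs with hu
      · rfl
      · exact h u hu
    rw [this]
    exact Submodule.sum_mem _ fun a ha =>
      Submodule.smul_mem _ _ (Submodule.subset_span ⟨a, ha, rfl⟩)

theorem IsPivotal.mul_eq_self_iff (hP : IsPivotal U P) {κ : Type*}
    {B : Matrix (Fin m ⊕ Fin m) κ F} :
    U.1 * B = B ↔ ∀ u ∉ P, ∀ v, B u v = 0 := by
  rw [mul_eq_self_iff_col_mem_fixedSpace]
  simp only [show fixedSpace U.1 = _ from hP, mem_span_single_iff]
  exact ⟨fun h u hu v => h v u hu, fun h v u hu => h u hu v⟩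

/-- The rows fixed by `U` are those supported in the leading columns. -/
theorem IsPivotal.eq_mul_self_iff (hP : IsPivotal U P) {κ : Type*}
    {C : Matrix κ (Fin m ⊕ Fin m) F} :
    C * U.1 = C ↔ ∀ u, u.swap ∉ P → ∀ v, C v u = 0 := by
  rw [mul_Sp_eq_self_iff, hP.mul_eq_self_iff]
  have key : ∀ u v, (formQ m F * Cᵀ) u v = -(C v u.swap * formQ m F u.swap u) := by
    intro u v
    have h1 : formQ m F * Cᵀ = -((C.transpose.transpose * formQ m F)ᵀ) := by
      rw [transpose_mul, formQ_transpose]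
      simp
    rw [h1, neg_apply, transpose_apply, transpose_mul_formQ_apply, transpose_apply]
  simp only [key, neg_eq_zero, mul_eq_zero, formQ_swap_ne_zero, or_false]
  constructor
  · intro h u hu v
    simpa using h u.swap hu v
  · intro h u hu v
    exact h u.swap (by simpa using hu) v

/-- A matrix commuting with `U` preserves the fixed space of `U`. -/
theorem IsPivotal.apply_eq_zero_of_mem (hP : IsPivotal U P)
    {A : Matrix (Fin m ⊕ Fin m) (Fin m ⊕ Fin m) F}
    (hA : U.1 * A = A * U.1) {u b : Fin m ⊕ Fin m} (hb : b ∈ P) (hu : u ∉ P) :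
    A u b = 0 := by
  -- the columns of `E` are a basis of the fixed space
  let E : Matrix (Fin m ⊕ Fin m) P F := (1 : Matrix _ _ F).submatrix id Subtype.val
  have hE : U.1 * E = E := by
    rw [hP.mul_eq_self_iff]
    intro u hu v
    exact one_apply_ne (by rintro rfl; exact hu v.2)
  have h1 : U.1 * (A * E) = A * E := by
    rw [← Matrix.mul_assoc, hA, Matrix.mul_assoc, hE]
  have h2 := hP.mul_eq_self_iff.1 h1 u hu ⟨b, hb⟩
  simpa [E, mul_apply, one_apply] using h2

/-- A matrix commuting with `U` preserves the range of `U - 1`, which is spanned by the basis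
vectors other than the leading ones. -/
theorem IsPivotal.apply_swap_eq_zero (hP : IsPivotal U P)
    {A : Matrix (Fin m ⊕ Fin m) (Fin m ⊕ Fin m) F}
    (hA : U.1 * A = A * U.1) {u a : Fin m ⊕ Fin m} (ha : a ∈ P) (hu : u.swap ∉ P) :
    A a.swap u = 0 := by
  let E : Matrix P (Fin m ⊕ Fin m) F := (1 : Matrix _ _ F).submatrix (fun a => a.1.swap) id
  have hE : E * U.1 = E := by
    rw [hP.eq_mul_self_iff]
    intro u hu v
    refine one_apply_ne ?_
    rintro rfl
    exact hu (by simp)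
  have h1 : (E * A) * U.1 = E * A := by
    rw [Matrix.mul_assoc, ← hA, ← Matrix.mul_assoc, hE]
  have h2 := hP.eq_mul_self_iff.1 h1 u hu ⟨a, ha⟩
  simpa [E, mul_apply, one_apply] using h2

/-- For columns in the fixed space, the Gram matrix with the columns of `A` is determined by the
leading submatrix of `A`. -/
theorem IsPivotal.transpose_mul_formQ_mul_apply (hP : IsPivotal U P)
    {A : Matrix (Fin m ⊕ Fin m) (Fin m ⊕ Fin m) F} (hA : U.1 * A = A * U.1)
    {κ : Type*} {X : Matrix (Fin m ⊕ Fin m) κ F} (hX : ∀ u ∉ P, ∀ v, X u v = 0)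
    (u : Fin m ⊕ Fin m) (v : κ) :
    (Aᵀ * formQ m F * X) u v = if h : u.swap ∈ P then
      (((leadSub P A)ᵀ * sigmaMat F P) * X.submatrix (fun a : P => a.1) id) ⟨u.swap, h⟩ v
      else 0 := by
  rw [mul_apply, ← Finset.sum_subset (Finset.subset_univ P)
    (fun w _ hw => by rw [hX w hw, mul_zero]), ← Finset.sum_coe_sort]
  split_ifs with h
  · rw [mul_apply]
    refine Finset.sum_congr rfl fun a _ => ?_
    rw [transpose_mul_formQ_apply, sigmaMat, mul_diagonal]
    simp [leadSub]
  · refine Finset.sum_eq_zero fun a _ => ?_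
    rw [transpose_mul_formQ_apply, hP.apply_swap_eq_zero hA a.2 h, zero_mul, zero_mul]

theorem isUnit_det_sigmaMat (P : Finset (Fin m ⊕ Fin m)) : IsUnit (sigmaMat F P).det := by
  rw [sigmaMat, det_diagonal, isUnit_iff_ne_zero]
  exact Finset.prod_ne_zero_iff.2 fun a _ => formQ_swap_ne_zero _

/-- The upper left block `A` of an isometry centralizing `diag(U, 1)` acts invertibly on the
quotient by the range of `U - 1`: as `N` vanishes on the fixed space, `A` preserves the pairing of the fixed
space with this quotient. -/
theorem IsPivotal.isUnit_det_leadSub (hP : IsPivotal U P) (hiso : ∀ a ∈ P, a.swap ∉ P)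
    {k : ℕ} {A : Matrix (Fin m ⊕ Fin m) (Fin m ⊕ Fin m) F}
    {N : Matrix (Fin k ⊕ Fin k) (Fin m ⊕ Fin m) F}
    (hA : U.1 * A = A * U.1) (hN : N * U.1 = N)
    (h : Aᵀ * formQ m F * A + Nᵀ * formQ k F * N = formQ m F) :
    IsUnit ((leadSub P A)ᵀ * sigmaMat F P).det := by
  let X : Matrix (Fin m ⊕ Fin m) P F := A.submatrix id Subtype.val
  have hX : ∀ u ∉ P, ∀ v, X u v = 0 := fun u hu v => hP.apply_eq_zero_of_mem hA v.2 hu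
  have key : (leadSub P A)ᵀ * sigmaMat F P * X.submatrix (fun a : P => a.1) id =
      sigmaMat F P := by
    ext b a
    have h1 := hP.transpose_mul_formQ_mul_apply hA hX b.1.swap a
    rw [dif_pos (by simp)] at h1
    have h2 := congrFun (congrFun h b.1.swap) a.1
    rw [Matrix.add_apply] at h2
    have h3 : (Nᵀ * formQ k F * N) b.1.swap a.1 = 0 := by
      rw [mul_apply]
      refine Finset.sum_eq_zero fun w _ => ?_
      rw [hP.eq_mul_self_iff.1 hN _ (hiso _ a.2), mul_zero]
    rw [h3, add_zero] at h2
    have h4 : (sigmaMat F P) b a = formQ m F b.1.swap a.1 := by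
      rw [sigmaMat, diagonal_apply]
      split_ifs with hab
      · rw [hab]
      · rw [formQ_apply_eq_zero]
        rw [Sum.swap_swap]
        exact fun hc => hab (Subtype.ext hc.symm)
    rw [h4, ← h2]
    simp only [Sum.swap_swap] at h1
    exact h1.symm
  have h5 := congrArg det key
  rw [det_mul] at h5
  exact isUnit_of_mul_isUnit_left (h5 ▸ isUnit_det_sigmaMat P)

theorem leadSub_overlineMat (hiso : ∀ a ∈ P, a.swap ∉ P) (A : Matrix P P F) :
    leadSub P (overlineMat P A) = 0 := by
  ext a b
  simp [leadSub, overlineMat, hiso a.1 a.2]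

theorem IsPivotal.mul_overlineMat (hP : IsPivotal U P) (A : Matrix P P F) :
    U.1 * overlineMat P A = overlineMat P A := by
  rw [hP.mul_eq_self_iff]
  intro u hu v
  simp [overlineMat, hu]

theorem IsPivotal.overlineMat_mul (hP : IsPivotal U P) (A : Matrix P P F) :
    overlineMat P A * U.1 = overlineMat P A := by
  rw [hP.eq_mul_self_iff]
  intro u hu v
  simp [overlineMat, hu]

/-- The values of the form between two matrices with columns in the (isotropic) fixed space
vanish. -/
theorem transpose_mul_formQ_mul_eq_zero (hiso : ∀ a ∈ P, a.swap ∉ P) {κ κ' : Type*}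
    {X : Matrix (Fin m ⊕ Fin m) κ F} {Y : Matrix (Fin m ⊕ Fin m) κ' F}
    (hX : ∀ u ∉ P, ∀ v, X u v = 0) (hY : ∀ u ∉ P, ∀ v, Y u v = 0) :
    Xᵀ * formQ m F * Y = 0 := by
  ext u v
  rw [mul_apply]
  refine Finset.sum_eq_zero fun w _ => ?_
  rw [transpose_mul_formQ_apply]
  by_cases hw : w ∈ P
  · rw [hX _ (hiso w hw), zero_mul, zero_mul]
  · rw [hY w hw, mul_zero]

/-- The mixed part of the symplectic condition determines the pivotal rows of the upper right
block. -/
theorem IsPivotal.mixed_block_iff (hP : IsPivotal U P) {k : ℕ}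
    {A : Matrix (Fin m ⊕ Fin m) (Fin m ⊕ Fin m) F}
    {B : Matrix (Fin m ⊕ Fin m) (Fin k ⊕ Fin k) F}
    {N : Matrix (Fin k ⊕ Fin k) (Fin m ⊕ Fin m) F}
    {D : Matrix (Fin k ⊕ Fin k) (Fin k ⊕ Fin k) F}
    (hA : U.1 * A = A * U.1) (hB : U.1 * B = B)
    (hN : N * U.1 = N)
    (hL : IsUnit ((leadSub P A)ᵀ * sigmaMat F P).det) :
    Aᵀ * formQ m F * B + Nᵀ * formQ k F * D = 0 ↔
      B.submatrix (fun a : P => a.1) id = -(((leadSub P A)ᵀ * sigmaMat F P)⁻¹ *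
        (Nᵀ * formQ k F * D).submatrix (fun a : P => a.1.swap) id) := by
  have hB' := hP.mul_eq_self_iff.1 hB
  have hN' := hP.eq_mul_self_iff.1 hN
  have h1 := hP.transpose_mul_formQ_mul_apply hA hB'
  have h2 : B.submatrix (fun a : P => a.1) id = -(((leadSub P A)ᵀ * sigmaMat F P)⁻¹ *
        (Nᵀ * formQ k F * D).submatrix (fun a : P => a.1.swap) id) ↔
      ((leadSub P A)ᵀ * sigmaMat F P) * B.submatrix (fun a : P => a.1) id =
        -(Nᵀ * formQ k F * D).submatrix (fun a : P => a.1.swap) id := by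
    rw [← Matrix.mul_neg]
    constructor
    · intro h
      rw [h, mul_nonsing_inv_cancel_left _ _ hL]
    · intro h
      rw [← h, nonsing_inv_mul_cancel_left _ _ hL]
  rw [h2, add_eq_zero_iff_eq_neg]
  constructor
  · intro h
    ext a v
    have h3 := congrFun (congrFun h a.1.swap) v
    rw [h1, dif_pos (by simp)] at h3
    simpa using h3
  · intro h
    ext u v
    rw [h1]
    split_ifs with hu
    · rw [h]
      simp
    · rw [neg_apply, mul_apply, Finset.sum_eq_zero, neg_zero]
      intro w _
      rw [transpose_mul_formQ_apply, hN' u hu, zero_mul, zero_mul]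

/-- The correction `E` of the upper left block `A` satisfies `Q(A x, E y) = Q(N x, N y) / 2`;
as the range of `E` is isotropic, adding `E` to `A` adds the Gram matrix of `N`. -/
theorem IsPivotal.add_overlineMat_mem_Sp_iff (hP : IsPivotal U P)
    (hiso : ∀ a ∈ P, a.swap ∉ P) (h2 : (2 : F) ≠ 0) {k : ℕ}
    {A : Matrix (Fin m ⊕ Fin m) (Fin m ⊕ Fin m) F}
    {N : Matrix (Fin k ⊕ Fin k) (Fin m ⊕ Fin m) F}
    (hA : U.1 * A = A * U.1) (hN : N * U.1 = N)
    (hL : IsUnit ((leadSub P A)ᵀ * sigmaMat F P).det) :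
    A + overlineMat P ((2 : F)⁻¹ • (((leadSub P A)ᵀ * sigmaMat F P)⁻¹ *
        (Nᵀ * formQ k F * N).submatrix (fun a : P => a.1.swap) (fun b : P => b.1.swap))) ∈ Sp m F ↔
      Aᵀ * formQ m F * A + Nᵀ * formQ k F * N = formQ m F := by
  set S := Nᵀ * formQ k F * N with hS
  set L := (leadSub P A)ᵀ * sigmaMat F P
  set X := (2 : F)⁻¹ • (L⁻¹ * S.submatrix (fun a : P => a.1.swap) (fun b : P => b.1.swap))
  set E := overlineMat P X with hE
  have hErow := hP.mul_eq_self_iff.1 (hP.mul_overlineMat X)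
  have hN' := hP.eq_mul_self_iff.1 hN
  have hAE : Aᵀ * formQ m F * E = (2 : F)⁻¹ • S := by
    ext u v
    rw [hP.transpose_mul_formQ_mul_apply hA hErow]
    split_ifs with hu
    · by_cases hv : v.swap ∈ P
      · have h3 : L * X = (2 : F)⁻¹ •
            S.submatrix (fun a : P => a.1.swap) (fun b : P => b.1.swap) := by
          rw [Matrix.mul_smul, mul_nonsing_inv_cancel_left _ _ hL]
        have h4 := congrFun (congrFun h3 ⟨u.swap, hu⟩) ⟨v.swap, hv⟩
        simp only [Matrix.smul_apply, submatrix_apply, Sum.swap_swap] at h4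
        rw [Matrix.smul_apply, ← h4, mul_apply, mul_apply]
        refine Finset.sum_congr rfl fun a _ => ?_
        simp [overlineMat, hv, L]
      · rw [Matrix.smul_apply, hS, mul_apply, mul_apply, Finset.sum_eq_zero, Finset.sum_eq_zero,
          smul_zero]
        · intro w _
          rw [hN' v hv, mul_zero]
        · intro w _
          simp [overlineMat, hv]
    · rw [Matrix.smul_apply, hS, mul_apply, Finset.sum_eq_zero, smul_zero]
      intro w _
      rw [transpose_mul_formQ_apply, hN' u hu, zero_mul, zero_mul]
  have hST : Sᵀ = -S := by
    simp [hS, formQ_transpose, Matrix.mul_assoc]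
  have hEA : Eᵀ * formQ m F * A = (2 : F)⁻¹ • S := by
    have h3 := congrArg transpose hAE
    rw [transpose_smul, hST, transpose_mul, transpose_mul, transpose_transpose,
      formQ_transpose] at h3
    simpa [Matrix.mul_assoc] using h3
  have hEE : Eᵀ * formQ m F * E = 0 := transpose_mul_formQ_mul_eq_zero hiso hErow hErow
  rw [mem_Sp_iff, transpose_add, Matrix.add_mul, Matrix.add_mul, Matrix.mul_add, Matrix.mul_add,
    hAE, hEA, hEE, add_zero, add_assoc, ← add_smul]
  have : (2 : F)⁻¹ + (2 : F)⁻¹ = 1 := by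
    rw [← two_mul, mul_inv_cancel₀ h2]
  rw [this, one_smul]

end Pivotal

/-! ### Block description of centralizers -/

/-- The centralizer of a pair `U₁, U₂` both of which fix the fixed space of `U₁ * U₂`. -/
theorem image_centralizer_eq_blockSet (h2 : (2 : F) ≠ 0) (hmn : m ≤ n) {U₁ U₂ : Sp m F}
    (hfix₁ : fixedSpace (U₁ * U₂ : Sp m F).1 ≤ fixedSpace U₁.1)
    (hfix₂ : fixedSpace (U₁ * U₂ : Sp m F).1 ≤ fixedSpace U₂.1)
    {P : Finset (Fin m ⊕ Fin m)} (hP : IsPivotal (U₁ * U₂) P) (hiso : ∀ a ∈ P, a.swap ∉ P) :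
    Subtype.val '' ((Subgroup.centralizer {upup hmn U₁} ⊓
        Subgroup.centralizer {upup hmn U₂} : Subgroup (Sp n F)) : Set (Sp n F)) =
      blockSet P hmn (U₁ * U₂) (Subgroup.centralizer {U₁} ⊓ Subgroup.centralizer {U₂}) := by
  have hcomm : ∀ A : Matrix (Fin m ⊕ Fin m) (Fin m ⊕ Fin m) F, U₁.1 * A = A * U₁.1 →
      U₂.1 * A = A * U₂.1 →
      (U₁ * U₂ : Sp m F).1 * A = A * (U₁ * U₂ : Sp m F).1 := by
    intro A h1 h2
    rw [Submonoid.coe_mul, Matrix.mul_assoc, h2, ← Matrix.mul_assoc, h1, Matrix.mul_assoc]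
  have hcol : ∀ V : Sp m F,
      fixedSpace (U₁ * U₂ : Sp m F).1 ≤ fixedSpace V.1 →
      ∀ {κ : Type} {B : Matrix (Fin m ⊕ Fin m) κ F},
      (U₁ * U₂ : Sp m F).1 * B = B → V.1 * B = B := by
    intro V hV κ B hB
    rw [mul_eq_self_iff_col_mem_fixedSpace] at hB ⊢
    exact fun v => hV (hB v)
  have hrow : ∀ V : Sp m F,
      fixedSpace (U₁ * U₂ : Sp m F).1 ≤ fixedSpace V.1 →
      ∀ {κ : Type} {C : Matrix κ (Fin m ⊕ Fin m) F},
      C * (U₁ * U₂ : Sp m F).1 = C → C * V.1 = C := by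
    intro V hV κ C hC
    rw [mul_Sp_eq_self_iff] at hC ⊢
    exact hcol V hV hC
  have hover : ∀ V : Sp m F,
      fixedSpace (U₁ * U₂ : Sp m F).1 ≤ fixedSpace V.1 →
      ∀ X : Matrix P P F,
      V.1 * overlineMat P X = overlineMat P X * V.1 := by
    intro V hV X
    rw [hcol V hV (hP.mul_overlineMat X), hrow V hV (hP.overlineMat_mul X)]
  ext M
  constructor
  · rintro ⟨M, ⟨hM1, hM2⟩, rfl⟩
    obtain ⟨A, B, N, D, hM⟩ := exists_eq_ofBlocks hmn M.1
    obtain ⟨hA1, hB1, hN1⟩ := (mem_centralizer_upup_iff hmn U₁ M hM).1 hM1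
    obtain ⟨hA2, hB2, hN2⟩ := (mem_centralizer_upup_iff hmn U₂ M hM).1 hM2
    have hA := hcomm A hA1 hA2
    have hB : (U₁ * U₂ : Sp m F).1 * B = B := by
      rw [Submonoid.coe_mul, Matrix.mul_assoc, hB2, hB1]
    have hN : N * (U₁ * U₂ : Sp m F).1 = N := by
      rw [Submonoid.coe_mul, ← Matrix.mul_assoc, hN1, hN2]
    have hSp := M.2
    rw [hM, ofBlocks_mem_Sp_iff] at hSp
    obtain ⟨h11, h12, h22⟩ := hSp
    have hB' := hP.mul_eq_self_iff.1 hB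
    rw [transpose_mul_formQ_mul_eq_zero hiso hB' hB', zero_add, ← mem_Sp_iff] at h22
    have hL := hP.isUnit_det_leadSub hiso hA hN h11
    refine ⟨A, B, N, D, hM, h22, hB, hN, (hP.mixed_block_iff hA hB hN hL).1 h12,
      ⟨_, (hP.add_overlineMat_mem_Sp_iff hiso h2 hA hN hL).2 h11⟩, ⟨?_, ?_⟩, rfl⟩
    · refine (mem_centralizer_Sp_iff _ _).2 ?_
      rw [Matrix.mul_add, Matrix.add_mul, hA1, hover U₁ hfix₁]
    · refine (mem_centralizer_Sp_iff _ _).2 ?_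
      rw [Matrix.mul_add, Matrix.add_mul, hA2, hover U₂ hfix₂]
  · rintro ⟨A, B, N, D, rfl, hD, hB, hN, hBP, D₀, ⟨hD1, hD2⟩, hAD⟩
    replace hD1 := (mem_centralizer_Sp_iff _ _).1 hD1
    replace hD2 := (mem_centralizer_Sp_iff _ _).1 hD2
    have hAD' := eq_sub_of_add_eq hAD
    have hA1 : U₁.1 * A = A * U₁.1 := by
      rw [hAD', Matrix.mul_sub, Matrix.sub_mul, hD1, hover U₁ hfix₁]
    have hA2 : U₂.1 * A = A * U₂.1 := by
      rw [hAD', Matrix.mul_sub, Matrix.sub_mul, hD2, hover U₂ hfix₂]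
    have hA := hcomm A hA1 hA2
    have hlead : leadSub P A = leadSub P D₀.1 := by
      rw [← hAD]
      rw [show ∀ X, leadSub P (A + X) = leadSub P A + leadSub P X from fun X => rfl,
        leadSub_overlineMat hiso, add_zero]
    have hL : IsUnit ((leadSub P A)ᵀ * sigmaMat F P).det := by
      rw [hlead]
      -- the symplectic matrix `D₀` itself, with an empty complement
      refine hP.isUnit_det_leadSub hiso (k := 0) (N := 0) (hcomm _ hD1 hD2)
        (by rw [Matrix.zero_mul]) ?_
      simpa using mem_Sp_iff.1 D₀.2
    have h11 := (hP.add_overlineMat_mem_Sp_iff hiso h2 hA hN hL).1 (by rw [hAD]; exact D₀.2)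
    have h12 := (hP.mixed_block_iff hA hB hN hL).2 hBP
    have hB' := hP.mul_eq_self_iff.1 hB
    have hSp : ofBlocks hmn A B N D ∈ Sp n F := by
      rw [ofBlocks_mem_Sp_iff]
      refine ⟨h11, h12, ?_⟩
      rw [transpose_mul_formQ_mul_eq_zero hiso hB' hB', zero_add, ← mem_Sp_iff]
      exact hD
    refine ⟨⟨_, hSp⟩, ⟨?_, ?_⟩, rfl⟩
    · exact (mem_centralizer_upup_iff hmn U₁ ⟨_, hSp⟩ rfl).2
        ⟨hA1, hcol U₁ hfix₁ hB, hrow U₁ hfix₁ hN⟩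
    · exact (mem_centralizer_upup_iff hmn U₂ ⟨_, hSp⟩ rfl).2
        ⟨hA2, hcol U₂ hfix₂ hB, hrow U₂ hfix₂ hN⟩

end Centralizer

/-! ### Hyperbolic bases adapted to an isotropic subspace -/

/-- A nondegenerate alternating form on `H` has a hyperbolic basis `e, f` such that a given
isotropic subspace `W` is spanned by part of `e`. The pair `e 0, f 0` is split off with `e 0 ∈ W`
if `W ≠ 0`, and the construction is repeated in the orthogonal complement. -/
theorem exists_hyperbolic_family {F V : Type*} [Field F] [AddCommGroup V] [Module F V]
    [FiniteDimensional F V] (B : LinearMap.BilinForm F V) (hB : B.IsAlt) (H W : Submodule F V)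
    (hWH : W ≤ H) (hH : ∀ x ∈ H, (∀ y ∈ H, B x y = 0) → x = 0)
    (hW : ∀ x ∈ W, ∀ y ∈ W, B x y = 0) :
    ∃ (k : ℕ) (e f : Fin k → V) (S : Set (Fin k)), (∀ i, e i ∈ H) ∧ (∀ i, f i ∈ H) ∧
      (∀ i j, B (e i) (e j) = 0) ∧ (∀ i j, B (f i) (f j) = 0) ∧
      (∀ i j, B (e i) (f j) = if i = j then 1 else 0) ∧
      H ≤ Submodule.span F (Set.range e ∪ Set.range f) ∧ W = Submodule.span F (e '' S) := by
  have hneg : ∀ x y, B x y = -B y x := fun x y => (LinearMap.IsAlt.neg hB y x).symm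
  induction hk : Module.finrank F H using Nat.strong_induction_on generalizing H W with
  | _ k ih =>
    by_cases hbot : H = ⊥
    · subst hbot
      refine ⟨0, Fin.elim0, Fin.elim0, ∅, fun i => i.elim0, fun i => i.elim0, fun i => i.elim0,
        fun i => i.elim0, fun i => i.elim0, bot_le, ?_⟩
      rw [Set.image_empty, Submodule.span_empty]
      exact le_bot_iff.1 hWH
    obtain ⟨w, hwH, hw0, hwW⟩ : ∃ w ∈ H, w ≠ 0 ∧ (W ≠ ⊥ → w ∈ W) := by
      by_cases hWbot : W = ⊥
      · obtain ⟨w, hw, hw0⟩ := Submodule.exists_mem_ne_zero_of_ne_bot hbot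
        exact ⟨w, hw, hw0, fun h => absurd hWbot h⟩
      · obtain ⟨w, hw, hw0⟩ := Submodule.exists_mem_ne_zero_of_ne_bot hWbot
        exact ⟨w, hWH hw, hw0, fun _ => hw⟩
    obtain ⟨y, hyH, hy⟩ : ∃ y ∈ H, B w y ≠ 0 := by
      by_contra! h
      exact hw0 (hH w hwH h)
    obtain ⟨g, hgH, hwg⟩ : ∃ g ∈ H, B w g = 1 :=
      ⟨(B w y)⁻¹ • y, H.smul_mem _ hyH, by rw [map_smul, smul_eq_mul, inv_mul_cancel₀ hy]⟩
    have hgw : B g w = -1 := by rw [hneg, hwg]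
    have hww : B w w = 0 := hB w
    have hgg : B g g = 0 := hB g
    let H' : Submodule F V := H ⊓ (LinearMap.ker (B w) ⊓ LinearMap.ker (B g))
    have memH' : ∀ x, x ∈ H' ↔ x ∈ H ∧ B w x = 0 ∧ B g x = 0 := fun x => by
      simp [H']
    -- the projection to the orthogonal complement `H'` of the hyperbolic plane of `w` and `g`
    have hproj : ∀ x ∈ H, x + B g x • w - B w x • g ∈ H' := by
      intro x hx
      refine (memH' _).2 ⟨H.sub_mem (H.add_mem hx (H.smul_mem _ hwH)) (H.smul_mem _ hgH), ?_, ?_⟩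
      · simp [hww, hwg]
      · simp [hgg, hgw]
    have hlt : H' < H := by
      refine lt_of_le_of_ne inf_le_left fun h => ?_
      have hw' := ((memH' w).1 (h.symm ▸ hwH)).2.2
      rw [hgw] at hw'
      exact one_ne_zero (neg_eq_zero.1 hw')
    have hH' : ∀ x ∈ H', (∀ y ∈ H', B x y = 0) → x = 0 := by
      intro x hx h
      obtain ⟨hxH, hwx, hgx⟩ := (memH' x).1 hx
      refine hH x hxH fun y hy => ?_
      have h1 := h _ (hproj y hy)
      have hxw : B x w = 0 := by rw [hneg, hwx, neg_zero]
      have hxg : B x g = 0 := by rw [hneg, hgx, neg_zero]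
      simpa [hxw, hxg] using h1
    obtain ⟨l, e, f, S, he, hf, hee, hff, hef, hspan, hWS⟩ :=
      ih _ (hk ▸ Submodule.finrank_lt_finrank_of_lt hlt) H' (W ⊓ H') inf_le_right hH'
        (fun x hx y hy => hW x hx.1 y hy.1) rfl
    have hwe : ∀ i, B w (e i) = 0 := fun i => ((memH' _).1 (he i)).2.1
    have hge : ∀ i, B g (e i) = 0 := fun i => ((memH' _).1 (he i)).2.2
    have hwf : ∀ i, B w (f i) = 0 := fun i => ((memH' _).1 (hf i)).2.1
    have hgf : ∀ i, B g (f i) = 0 := fun i => ((memH' _).1 (hf i)).2.2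
    have hew : ∀ i, B (e i) w = 0 := fun i => by rw [hneg, hwe, neg_zero]
    have heg : ∀ i, B (e i) g = 0 := fun i => by rw [hneg, hge, neg_zero]
    have hfg : ∀ i, B (f i) g = 0 := fun i => by rw [hneg, hgf, neg_zero]
    refine ⟨l + 1, Fin.cons w e, Fin.cons g f, {i | i = 0 ∧ w ∈ W} ∪ Fin.succ '' S, ?_, ?_, ?_, ?_,
      ?_, ?_, ?_⟩
    · exact Fin.cases hwH fun i => hlt.le (he i)
    · exact Fin.cases hgH fun i => hlt.le (hf i)
    · intro i j
      refine Fin.cases (Fin.cases ?_ (fun j => ?_) j) (fun i => Fin.cases ?_ (fun j => ?_) j) i <;>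
        simp [hww, hwe, hew, hee]
    · intro i j
      refine Fin.cases (Fin.cases ?_ (fun j => ?_) j) (fun i => Fin.cases ?_ (fun j => ?_) j) i <;>
        simp [hgg, hgf, hfg, hff]
    · intro i j
      refine Fin.cases (Fin.cases ?_ (fun j => ?_) j) (fun i => Fin.cases ?_ (fun j => ?_) j) i <;>
        simp [hwg, hwf, heg, hef, Fin.succ_ne_zero, (Fin.succ_ne_zero _).symm]
    · intro x hx
      have hsub : Submodule.span F (Set.range e ∪ Set.range f) ≤
          Submodule.span F (Set.range (Fin.cons w e : Fin (l + 1) → V) ∪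
            Set.range (Fin.cons g f : Fin (l + 1) → V)) := by
        refine Submodule.span_mono (Set.union_subset_union ?_ ?_)
        · rintro _ ⟨i, rfl⟩
          exact ⟨i.succ, by simp⟩
        · rintro _ ⟨i, rfl⟩
          exact ⟨i.succ, by simp⟩
      have h1 := hsub (hspan (hproj x hx))
      have hw' : w ∈ Submodule.span F (Set.range (Fin.cons w e : Fin (l + 1) → V) ∪
            Set.range (Fin.cons g f : Fin (l + 1) → V)) :=
        Submodule.subset_span (Or.inl ⟨0, by simp⟩)
      have hg' : g ∈ Submodule.span F (Set.range (Fin.cons w e : Fin (l + 1) → V) ∪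
            Set.range (Fin.cons g f : Fin (l + 1) → V)) :=
        Submodule.subset_span (Or.inr ⟨0, by simp⟩)
      have h2 := Submodule.sub_mem _ (Submodule.add_mem _ h1 (Submodule.smul_mem _ (B w x) hg'))
        (Submodule.smul_mem _ (B g x) hw')
      convert h2 using 1
      abel
    · have himg : (Fin.cons w e : Fin (l + 1) → V) '' ({i | i = 0 ∧ w ∈ W} ∪ Fin.succ '' S) =
          {x | x = w ∧ w ∈ W} ∪ e '' S := by
        rw [Set.image_union, Set.image_image]
        congr 1
        ext x
        constructor
        · rintro ⟨i, ⟨rfl, h⟩, rfl⟩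
          exact ⟨by simp, h⟩
        · rintro ⟨rfl, h⟩
          exact ⟨0, ⟨rfl, h⟩, by simp⟩
      rw [himg, Submodule.span_union, ← hWS]
      refine le_antisymm (fun x hx => ?_) (sup_le (Submodule.span_le.2 ?_) inf_le_left)
      · by_cases hWbot : W = ⊥
        · rw [hWbot, Submodule.mem_bot] at hx
          rw [hx]
          exact Submodule.zero_mem _
        have hw' := hwW hWbot
        have h1 := hproj x (hWH hx)
        rw [hW w hw' x hx, zero_smul, sub_zero] at h1
        have h2 : x + B g x • w ∈ W ⊓ H' := ⟨W.add_mem hx (W.smul_mem _ hw'), h1⟩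
        have h3 : w ∈ Submodule.span F {x | x = w ∧ w ∈ W} := Submodule.subset_span ⟨rfl, hw'⟩
        have h4 := Submodule.sub_mem _ (Submodule.mem_sup_right h2)
          (Submodule.mem_sup_left (Submodule.smul_mem _ (B g x) h3))
        simpa using h4
      · rintro x ⟨rfl, h⟩
        exact h

section

variable {F : Type*} [Field F] {m : ℕ}

theorem dotProduct_formQ_mulVec_self (x : Fin m ⊕ Fin m → F) : x ⬝ᵥ formQ m F *ᵥ x = 0 := by
  rw [formQ, fromBlocks_mulVec, dotProduct, Fintype.sum_sum_type]
  simp [mul_comm, neg_mulVec]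

theorem dotProduct_formQ_mulVec_of_mem_Sp (U : Sp m F) (x y : Fin m ⊕ Fin m → F) :
    (U.1 *ᵥ x) ⬝ᵥ formQ m F *ᵥ (U.1 *ᵥ y) = x ⬝ᵥ formQ m F *ᵥ y := by
  conv_rhs => rw [← mem_Sp_iff.1 U.2]
  rw [← vecMul_transpose, ← dotProduct_mulVec, mulVec_mulVec, mulVec_mulVec]

theorem isUnit_det_formQ (m : ℕ) : IsUnit (formQ m F).det := by
  rw [formQ_eq_neg_J, ← J_inv]
  exact isUnit_nonsing_inv_det _ (isUnit_det_J _ _)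

/-- If the fixed space of `U` is isotropic, some symplectic conjugate of `U` has a fixed space
spanned by basis vectors: conjugate by the inverse of the matrix whose columns are a hyperbolic basis
adapted to the fixed space. -/
theorem exists_isPivotal_conj (U : Sp m F)
    (hiso : ∀ x ∈ fixedSpace U.1, ∀ y ∈ fixedSpace U.1, x ⬝ᵥ formQ m F *ᵥ y = 0) :
    ∃ (T : Sp m F) (P : Finset (Fin m ⊕ Fin m)), IsPivotal (T * U * T⁻¹) P := by
  classical
  have hBapp : ∀ x y, toBilin' (formQ m F) x y = x ⬝ᵥ formQ m F *ᵥ y := fun x y =>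
    Matrix.toBilin'_apply' _ _ _
  obtain ⟨k, e, f, S, -, -, hee, hff, hef, hspan, hWS⟩ :=
    exists_hyperbolic_family (toBilin' (formQ m F))
      (fun x => by rw [hBapp, dotProduct_formQ_mulVec_self]) ⊤ (fixedSpace U.1) le_top
      (fun x _ h => by
        have h1 : x ᵥ* formQ m F = 0 := by
          refine dotProduct_eq_zero _ fun y => ?_
          rw [← dotProduct_mulVec, ← hBapp]
          exact h y trivial
        have h2 := congrArg (· ᵥ* (formQ m F)⁻¹) h1
        simpa [vecMul_vecMul, mul_nonsing_inv _ (isUnit_det_formQ m)] using h2)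
      (fun x hx y hy => by rw [hBapp]; exact hiso x hx y hy)
  have hfe : ∀ i j, toBilin' (formQ m F) (f i) (e j) = -(if i = j then 1 else 0) := by
    intro i j
    have hAlt : (toBilin' (formQ m F)).IsAlt := fun x => by
      rw [hBapp, dotProduct_formQ_mulVec_self]
    rw [← LinearMap.IsAlt.neg hAlt (e j), hef]
    simp only [@eq_comm _ j i]
  let T : Matrix (Fin m ⊕ Fin m) (Fin k ⊕ Fin k) F := of fun u v => Sum.elim e f v u
  have hT : Tᵀ * formQ m F * T = formQ k F := by
    ext u v
    have h1 : (Tᵀ * formQ m F * T) u v =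
        toBilin' (formQ m F) (Sum.elim e f u) (Sum.elim e f v) := by
      rw [hBapp, dotProduct_mulVec]
      rfl
    rw [h1, show formQ k F = fromBlocks 0 1 (-1) 0 from rfl]
    rcases u with u | u <;> rcases v with v | v <;>
      simp [hee, hff, hef, hfe, one_apply]
  have hkm : k = m := by
    refine le_antisymm ?_ ?_
    · have h1 : (formQ k F).rank = Fintype.card (Fin k ⊕ Fin k) :=
        rank_of_isUnit _ ((isUnit_iff_isUnit_det _).2 (isUnit_det_formQ k))
      have h2 := rank_mul_le_right (Tᵀ * formQ m F) T
      have h3 := rank_le_card_height T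
      rw [hT, h1] at h2
      simp only [Fintype.card_sum, Fintype.card_fin] at h2 h3
      omega
    · have h1 := finrank_span_le_card (R := F) (Set.range e ∪ Set.range f)
      rw [top_le_iff.1 hspan, finrank_top, Module.finrank_fintype_fun_eq_card] at h1
      have h2 : (Set.range e ∪ Set.range f).toFinset ⊆
          Finset.univ.image e ∪ Finset.univ.image f := by
        intro x
        simp
      have h3 := (Finset.card_le_card h2).trans (Finset.card_union_le _ _)
      have h4 := Finset.card_image_le (s := Finset.univ) (f := e)
      have h5 := Finset.card_image_le (s := Finset.univ) (f := f)
      simp only [Fintype.card_sum, Fintype.card_fin, Finset.card_univ] at h1 h4 h5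
      omega
  subst hkm
  let T' : Sp k F := ⟨T, mem_Sp_iff.2 hT⟩
  have hcol : ∀ i, T *ᵥ Pi.single (Sum.inl i) 1 = e i := by
    intro i
    rw [mulVec_single_one]
    rfl
  have hinj : Function.Injective (toLin' T) := by
    have hunit : IsUnit T :=
      (isUnit_iff_isUnit_det T).2 (SymplecticGroup.symplectic_det T'.2)
    exact mulVec_injective_of_isUnit hunit
  refine ⟨T'⁻¹, S.toFinset.image Sum.inl, ?_⟩
  have hfix : fixedSpace (T'⁻¹ * U * T'⁻¹⁻¹).1 = (fixedSpace U.1).comap (toLin' T) := by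
    ext v
    rw [Submodule.mem_comap, mem_fixedSpace_iff, mem_fixedSpace_iff, inv_inv, toLin'_apply]
    have h1 : T *ᵥ ((T'⁻¹ * U * T').1 *ᵥ v) = U.1 *ᵥ (T *ᵥ v) := by
      rw [mulVec_mulVec, mulVec_mulVec]
      change (T' * (T'⁻¹ * U * T')).1 *ᵥ v = (U * T').1 *ᵥ v
      rw [mul_assoc, mul_inv_cancel_left]
    rw [← h1]
    exact ⟨fun h => by rw [h], fun h => hinj h⟩
  have himg : e '' S =
      toLin' T '' ((fun a => Pi.single a (1 : F)) ''
        ((S.toFinset.image Sum.inl : Finset (Fin k ⊕ Fin k)) : Set (Fin k ⊕ Fin k))) := by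
    rw [Finset.coe_image, Set.coe_toFinset, Set.image_image, Set.image_image]
    exact Set.image_congr fun i _ => by rw [toLin'_apply, hcol]
  rw [IsPivotal]
  refine hfix.trans ?_
  rw [hWS, himg, ← Submodule.map_span, Submodule.comap_map_eq_of_injective hinj]

end

/-! ### Counting the block matrices -/

section Counting

variable {F : Type*} [Field F] {m n : ℕ}

/-- The lower left block with prescribed leading columns, all other columns being zero. -/
noncomputable def leadingColumns (P : Finset (Fin m ⊕ Fin m)) {κ : Type*} (X : Matrix κ P F) :
    Matrix κ (Fin m ⊕ Fin m) F :=
  of fun v u => if h : u.swap ∈ P then X v ⟨u.swap, h⟩ else 0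

/-- The matrix of size `|P|` from which the correction of the upper left block is built. -/
noncomputable def correction (P : Finset (Fin m ⊕ Fin m)) {k : ℕ}
    (A : Matrix (Fin m ⊕ Fin m) (Fin m ⊕ Fin m) F)
    (N : Matrix (Fin k ⊕ Fin k) (Fin m ⊕ Fin m) F) : Matrix P P F :=
  (2 : F)⁻¹ • (((leadSub P A)ᵀ * sigmaMat F P)⁻¹ *
    (Nᵀ * formQ k F * N).submatrix (fun a : P => a.1.swap) (fun b : P => b.1.swap))

/-- The upper right block determined by the other blocks: its pivotal rows are given by the block
description of centralizers, all other rows are zero. -/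
noncomputable def pivotalRows (P : Finset (Fin m ⊕ Fin m)) {k : ℕ}
    (A : Matrix (Fin m ⊕ Fin m) (Fin m ⊕ Fin m) F)
    (N : Matrix (Fin k ⊕ Fin k) (Fin m ⊕ Fin m) F) (D : Matrix (Fin k ⊕ Fin k) (Fin k ⊕ Fin k) F) :
    Matrix (Fin m ⊕ Fin m) (Fin k ⊕ Fin k) F :=
  of fun u v => if h : u ∈ P then (-(((leadSub P A)ᵀ * sigmaMat F P)⁻¹ *
    (Nᵀ * formQ k F * D).submatrix (fun a : P => a.1.swap) id)) ⟨u, h⟩ v else 0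

/-- The element of `blockSet` with parameters `t = (D₀, D, X)`: `D₀` is the corrected upper left
block, `D` the lower right block, and `X` consists of the leading columns of the lower left block.
The correction does not change the leading submatrix, so it may be computed from `D₀`. -/
noncomputable def blockParam (P : Finset (Fin m ⊕ Fin m)) (h : m ≤ n) (C : Subgroup (Sp m F))
    (t : C × Sp (n - m) F × Matrix (Fin (n - m) ⊕ Fin (n - m)) P F) :
    Matrix (Fin n ⊕ Fin n) (Fin n ⊕ Fin n) F :=
  ofBlocks h
    (t.1.1.1 - overlineMat P (correction P t.1.1.1 (leadingColumns P t.2.2)))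
    (pivotalRows P t.1.1.1 (leadingColumns P t.2.2) t.2.1.1)
    (leadingColumns P t.2.2) t.2.1.1

variable {U : Sp m F} {P : Finset (Fin m ⊕ Fin m)}

theorem leadSub_add_overlineMat (hiso : ∀ a ∈ P, a.swap ∉ P)
    (A : Matrix (Fin m ⊕ Fin m) (Fin m ⊕ Fin m) F) (X : Matrix P P F) :
    leadSub P (A + overlineMat P X) = leadSub P A := by
  rw [show ∀ Y, leadSub P (A + Y) = leadSub P A + leadSub P Y from fun Y => rfl,
    leadSub_overlineMat hiso, add_zero]

theorem correction_congr {k : ℕ} {A A' : Matrix (Fin m ⊕ Fin m) (Fin m ⊕ Fin m) F}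
    (h : leadSub P A = leadSub P A') (N : Matrix (Fin k ⊕ Fin k) (Fin m ⊕ Fin m) F) :
    correction P A N = correction P A' N := by
  rw [correction, correction, h]

theorem blockParam_injective (hiso : ∀ a ∈ P, a.swap ∉ P) (h : m ≤ n) (C : Subgroup (Sp m F)) :
    Function.Injective (blockParam P h C) := by
  rintro ⟨D₀, D, X⟩ ⟨D₀', D', X'⟩ heq
  obtain ⟨hA, -, hN, hD⟩ := (ofBlocks_inj h).1 heq
  simp only at hA hN hD
  have hX : X = X' := by
    ext v a
    have h1 := congrFun (congrFun hN v) a.1.swap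
    simpa [leadingColumns] using h1
  subst hX
  have hlead : leadSub P D₀.1.1 = leadSub P D₀'.1.1 := by
    have h1 := congrArg (leadSub P) hA
    rwa [← leadSub_add_overlineMat hiso _ (correction P D₀.1.1 (leadingColumns P X)),
      sub_add_cancel, ← leadSub_add_overlineMat hiso (D₀'.1.1 - _)
        (correction P D₀'.1.1 (leadingColumns P X)), sub_add_cancel] at h1
  rw [correction_congr hlead] at hA
  have hD₀ : D₀ = D₀' := Subtype.ext (Subtype.ext (sub_left_injective hA))
  rw [hD₀, Subtype.ext hD]

theorem IsPivotal.range_blockParam (hP : IsPivotal U P) (hiso : ∀ a ∈ P, a.swap ∉ P)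
    (h : m ≤ n) (C : Subgroup (Sp m F)) :
    Set.range (blockParam P h C) = blockSet P h U C := by
  have hlead : ∀ A X, leadSub P (A - overlineMat P X) = leadSub (F := F) P A := by
    intro A X
    rw [← leadSub_add_overlineMat hiso (A - _) X, sub_add_cancel]
  ext M
  constructor
  · rintro ⟨⟨D₀, D, X⟩, rfl⟩
    refine ⟨_, _, _, _, rfl, D.2, ?_, ?_, ?_, D₀.1, D₀.2, ?_⟩
    · rw [hP.mul_eq_self_iff]
      intro u hu v
      simp [pivotalRows, hu]
    · rw [hP.eq_mul_self_iff]
      intro u hu v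
      simp [leadingColumns, hu]
    · rw [hlead]
      ext a v
      simp [pivotalRows]
    · rw [hlead]
      exact sub_add_cancel _ _
  · rintro ⟨A, B, N, D, rfl, hD, hB, hN, hBP, D₀, hD₀, hAD⟩
    have hAD' : A + overlineMat P (correction P A N) = D₀.1 := hAD
    have hl : leadSub P D₀.1 = leadSub P A := by
      rw [← hAD', leadSub_add_overlineMat hiso]
    have hNX : leadingColumns P (N.submatrix id fun a : P => a.1.swap) = N := by
      ext v u
      rw [leadingColumns, of_apply]
      split_ifs with hu
      · simp
      · rw [hP.eq_mul_self_iff.1 hN u hu]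
    refine ⟨⟨⟨D₀, hD₀⟩, ⟨D, hD⟩, N.submatrix id fun a : P => a.1.swap⟩, ?_⟩
    rw [blockParam, ofBlocks_inj]
    simp only [hNX]
    refine ⟨?_, ?_, trivial, trivial⟩
    · rw [correction_congr hl, ← hAD', add_sub_cancel_right]
    · ext u v
      rw [pivotalRows, of_apply, hl, ← hBP]
      split_ifs with hu
      · rfl
      · rw [hP.mul_eq_self_iff.1 hB u hu]

theorem IsPivotal.card_blockSet [Finite F] (hP : IsPivotal U P) (hiso : ∀ a ∈ P, a.swap ∉ P)
    (h : m ≤ n) (C : Subgroup (Sp m F)) :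
    Nat.card (blockSet P h U C) = Nat.card C * Nat.card (Sp (n - m) F) *
      Nat.card F ^ (2 * P.card * (n - m)) := by
  rw [← hP.range_blockParam hiso, Nat.card_range_of_injective (blockParam_injective hiso h C),
    Nat.card_prod, Nat.card_prod, mul_assoc]
  congr 2
  rw [Matrix, Nat.card_fun, Nat.card_fun, ← pow_mul]
  congr 1
  simp only [Nat.card_eq_fintype_card, Fintype.card_coe, Fintype.card_sum, Fintype.card_fin]
  ring

theorem IsPivotal.finrank_fixedSpace (hP : IsPivotal U P) :
    Module.finrank F (fixedSpace U.1) = P.card := by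
  classical
  rw [show fixedSpace U.1 = _ from hP, ← Finset.coe_image, finrank_span_finset_eq_card,
    Finset.card_image_of_injective]
  · intro a b hab
    by_contra hne
    have h1 := congrFun hab a
    simp [hne] at h1
  · have h1 := (Pi.basisFun F (Fin m ⊕ Fin m)).linearIndependent
    have h2 := h1.linearIndepOn_id.mono (t := ((P.image fun a => Pi.single a (1 : F) :
      Finset _) : Set _)) ?_
    · exact h2
    · intro x hx
      obtain ⟨a, -, rfl⟩ := Finset.mem_image.1 (Finset.mem_coe.1 hx)
      exact ⟨a, by simp⟩

end Counting

/-! ### Conjugation -/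

section Conjugation

variable {F : Type*} [Field F] {m n : ℕ}

theorem centralizer_inf_conj {G : Type*} [Group G] (g x y : G) :
    (Subgroup.centralizer {g * x * g⁻¹} ⊓ Subgroup.centralizer {g * y * g⁻¹} : Subgroup G) =
      (Subgroup.centralizer {x} ⊓ Subgroup.centralizer {y}).map (MulAut.conj g).toMonoidHom := by
  have key : ∀ z a : G, a * (g * z * g⁻¹) = g * z * g⁻¹ * a ↔
      g⁻¹ * a * g * z = z * (g⁻¹ * a * g) := by
    intro z a
    constructor <;> intro h
    · have := congrArg (fun t => g⁻¹ * t * g) h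
      simpa [mul_assoc] using this
    · have := congrArg (fun t => g * t * g⁻¹) h
      simpa [mul_assoc] using this
  ext a
  rw [Subgroup.mem_map_equiv, Subgroup.mem_inf, Subgroup.mem_inf]
  simp only [Subgroup.mem_centralizer_singleton_iff, MulAut.conj_symm_apply, key]

theorem card_centralizer_inf_conj {G : Type*} [Group G] (g x y : G) :
    Nat.card ↥(Subgroup.centralizer {g * x * g⁻¹} ⊓ Subgroup.centralizer {g * y * g⁻¹}) =
      Nat.card ↥(Subgroup.centralizer {x} ⊓ Subgroup.centralizer {y}) := by
  rw [centralizer_inf_conj]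
  exact Subgroup.card_map_of_injective (MulAut.conj g).injective

theorem centralizer_inf_centralizer_one {G : Type*} [Group G] (g : G) :
    Subgroup.centralizer {g} ⊓ Subgroup.centralizer {(1 : G)} = Subgroup.centralizer {g} := by
  ext a
  simp [Subgroup.mem_centralizer_singleton_iff]

theorem upup_one (h : m ≤ n) : upup h (1 : Sp m F) = 1 := by
  refine Subtype.ext ?_
  change ofBlocks h 1 0 0 1 = 1
  rw [ofBlocks, fromBlocks_one, reindex_apply, submatrix_one_equiv]

theorem upup_mul (h : m ≤ n) (V W : Sp m F) : upup h (V * W) = upup h V * upup h W := by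
  refine Subtype.ext ?_
  change ofBlocks h (V.1 * W.1) 0 0 1 = ofBlocks h V.1 0 0 1 * ofBlocks h W.1 0 0 1
  rw [ofBlocks_mul]
  simp

theorem upup_conj (h : m ≤ n) (T V : Sp m F) :
    upup h (T * V * T⁻¹) = upup h T * upup h V * (upup h T)⁻¹ := by
  rw [eq_mul_inv_iff_mul_eq, ← upup_mul, ← upup_mul, inv_mul_cancel_right]

theorem mem_fixedSpace_conj_iff (T V : Sp m F) (v : Fin m ⊕ Fin m → F) :
    v ∈ fixedSpace (T * V * T⁻¹).1 ↔ T⁻¹.1 *ᵥ v ∈ fixedSpace V.1 := by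
  have h1 : T⁻¹.1 * (T * V * T⁻¹).1 = V.1 * T⁻¹.1 := by
    change (T⁻¹ * (T * V * T⁻¹)).1 = (V * T⁻¹).1
    group
  have h2 : (T * V * T⁻¹).1 = T.1 * (V.1 * T⁻¹.1) := by
    rw [mul_assoc]
    rfl
  have h3 : T.1 * T⁻¹.1 = 1 := by
    change (T * T⁻¹).1 = 1
    rw [mul_inv_cancel]
    rfl
  rw [mem_fixedSpace_iff, mem_fixedSpace_iff]
  constructor
  · intro h
    rw [mulVec_mulVec, ← h1, ← mulVec_mulVec, h]
  · intro h
    rw [mulVec_mulVec] at h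
    rw [h2, ← mulVec_mulVec, h, mulVec_mulVec, h3, one_mulVec]

theorem finrank_fixedSpace_conj (T V : Sp m F) :
    Module.finrank F (fixedSpace (T * V * T⁻¹).1) = Module.finrank F (fixedSpace V.1) := by
  have h3 : T.1 * T⁻¹.1 = 1 := by
    change (T * T⁻¹).1 = 1
    rw [mul_inv_cancel]
    rfl
  have h4 : T⁻¹.1 * T.1 = 1 := by
    change (T⁻¹ * T).1 = 1
    rw [inv_mul_cancel]
    rfl
  have h5 : ∀ v, T⁻¹.1 *ᵥ (T.1 *ᵥ v) = v := fun v => by rw [mulVec_mulVec, h4, one_mulVec]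
  have hmap : (fixedSpace (T * V * T⁻¹).1).map
      (toLin'OfInv h3 h4 : (Fin m ⊕ Fin m → F) →ₗ[F] _) = fixedSpace V.1 := by
    ext v
    constructor
    · rintro ⟨w, hw, rfl⟩
      exact (mem_fixedSpace_conj_iff T V w).1 hw
    · intro hv
      exact ⟨T.1 *ᵥ v, (mem_fixedSpace_conj_iff T V _).2 (by rwa [h5]), h5 v⟩
  rw [← hmap, LinearEquiv.finrank_map_eq]

end Conjugation

/-! ### Growth of centralizers -/

section Growth

variable {F : Type*} [Field F] {m n : ℕ}

/-- As `range (U - 1)` is orthogonal to the fixed space of the isometry `U`, the fixed space is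
isotropic once it is contained in `range (U - 1)`. -/
theorem dotProduct_formQ_mulVec_eq_zero_of_hasType {U : Sp m F} {lam : PartFun F}
    (hlam : HasType U.1 lam) (hweight : lam.modification.completion.weight = 2 * m)
    {x y : Fin m ⊕ Fin m → F} (hx : x ∈ fixedSpace U.1) (hy : y ∈ fixedSpace U.1) :
    x ⬝ᵥ formQ m F *ᵥ y = 0 := by
  rw [mem_fixedSpace_iff] at hx hy
  obtain ⟨z, rfl⟩ := hlam.exists_sub_eq (by simp [hweight, two_mul]) hx
  rw [sub_dotProduct, ← dotProduct_formQ_mulVec_of_mem_Sp U z y, hy, sub_self]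

theorem IsPivotal.swap_notMem {U : Sp m F} {P : Finset (Fin m ⊕ Fin m)} (hP : IsPivotal U P)
    (hiso : ∀ x ∈ fixedSpace U.1, ∀ y ∈ fixedSpace U.1, x ⬝ᵥ formQ m F *ᵥ y = 0) :
    ∀ a ∈ P, a.swap ∉ P := by
  intro a ha ha'
  have hmem : ∀ b ∈ P, Pi.single b (1 : F) ∈ fixedSpace U.1 := by
    intro b hb
    rw [show fixedSpace U.1 = _ from hP]
    exact Submodule.subset_span ⟨b, hb, rfl⟩
  have h := hiso _ (hmem _ ha') _ (hmem a ha)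
  rw [mulVec_single_one, single_dotProduct, one_mul] at h
  exact formQ_swap_ne_zero a h

/-- The order of the centralizer of a pair. As the orders are invariant under conjugation, the
fixed space may be assumed to be spanned by basis vectors; then the block matrices of the
centralizer are counted. -/
theorem card_centralizer_upup_inf [Finite F] (h2 : (2 : F) ≠ 0) (hmn : m ≤ n) {U₁ U₂ : Sp m F}
    (hfix₁ : fixedSpace (U₁ * U₂).1 ≤ fixedSpace U₁.1)
    (hfix₂ : fixedSpace (U₁ * U₂).1 ≤ fixedSpace U₂.1)
    (hiso : ∀ x ∈ fixedSpace (U₁ * U₂).1, ∀ y ∈ fixedSpace (U₁ * U₂).1,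
      x ⬝ᵥ formQ m F *ᵥ y = 0) :
    Nat.card ↥(Subgroup.centralizer {upup hmn U₁} ⊓ Subgroup.centralizer {upup hmn U₂}) =
      Nat.card ↥(Subgroup.centralizer {U₁} ⊓ Subgroup.centralizer {U₂}) *
        Nat.card (Sp (n - m) F) *
          Nat.card F ^ (2 * Module.finrank F (fixedSpace (U₁ * U₂).1) * (n - m)) := by
  obtain ⟨T, P, hP⟩ := exists_isPivotal_conj (U₁ * U₂) hiso
  have hfix : ∀ V : Sp m F, fixedSpace (U₁ * U₂).1 ≤ fixedSpace V.1 →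
      fixedSpace (T * (U₁ * U₂) * T⁻¹).1 ≤ fixedSpace (T * V * T⁻¹).1 := by
    intro V hV v hv
    rw [mem_fixedSpace_conj_iff] at hv ⊢
    exact hV hv
  have hiso' : ∀ a ∈ P, a.swap ∉ P := by
    refine hP.swap_notMem fun x hx y hy => ?_
    rw [mem_fixedSpace_conj_iff] at hx hy
    rw [← dotProduct_formQ_mulVec_of_mem_Sp T⁻¹]
    exact hiso _ hx _ hy
  rw [← finrank_fixedSpace_conj T, hP.finrank_fixedSpace,
    ← card_centralizer_inf_conj T, ← card_centralizer_inf_conj (upup hmn T), ← upup_conj,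
    ← upup_conj]
  have hconj : T * (U₁ * U₂) * T⁻¹ = (T * U₁ * T⁻¹) * (T * U₂ * T⁻¹) := by group
  have hfix₁' := hfix U₁ hfix₁
  have hfix₂' := hfix U₂ hfix₂
  rw [hconj] at hP hfix₁' hfix₂'
  rw [← hP.card_blockSet hiso' hmn, ← image_centralizer_eq_blockSet h2 hmn hfix₁' hfix₂' hP hiso']
  exact (Nat.card_image_of_injective Subtype.val_injective _).symm

theorem fixedSpace_mul_le_of_rl_add {U₁ U₂ : Sp m F} (h : rl U₁ + rl U₂ = rl (U₁ * U₂)) :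
    fixedSpace (U₁ * U₂).1 ≤ fixedSpace U₁.1 ⊓ fixedSpace U₂.1 := by
  simp only [rl_eq_rank] at h
  exact fixedSpace_mul_le_of_rank_add h

end Growth

theorem mainTheorem2 {F : Type*} [Field F] [Finite F] (hq : Odd (Nat.card F))
    {m n : ℕ} (hmn : m ≤ n) (U : Sp m F)
    (lam : PartFun F)
    (hlam : HasType (U : Matrix (Fin m ⊕ Fin m) (Fin m ⊕ Fin m) F) lam)
    (hweight : lam.modification.completion.weight = 2 * m)
    (d : ℕ)
    (hd : d = Module.finrank F
      (fixedSpace (U : Matrix (Fin m ⊕ Fin m) (Fin m ⊕ Fin m) F))) :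
    Nat.card (Subgroup.centralizer {upup hmn U}) =
        Nat.card (Subgroup.centralizer {U}) * Nat.card (Sp (n - m) F) *
          Nat.card F ^ (2 * d * (n - m)) ∧
    (∀ U₁ U₂ : Sp m F, U = U₁ * U₂ → rl U₁ + rl U₂ = rl U →
      Nat.card ↥(Subgroup.centralizer {upup hmn U₁} ⊓ Subgroup.centralizer {upup hmn U₂}) =
        Nat.card ↥(Subgroup.centralizer {U₁} ⊓ Subgroup.centralizer {U₂}) *
          Nat.card (Sp (n - m) F) * Nat.card F ^ (2 * d * (n - m))) ∧
    (∃ (T : Sp m F) (P : Finset (Fin m ⊕ Fin m)), IsPivotal (T * U * T⁻¹) P) ∧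
    (∀ P : Finset (Fin m ⊕ Fin m), IsPivotal U P →
      (Subtype.val '' (Subgroup.centralizer {upup hmn U} : Set (Sp n F)) =
        blockSet P hmn U (Subgroup.centralizer {U})) ∧
      (∀ U₁ U₂ : Sp m F, U = U₁ * U₂ → rl U₁ + rl U₂ = rl U →
        Subtype.val '' ((Subgroup.centralizer {upup hmn U₁} ⊓
            Subgroup.centralizer {upup hmn U₂} : Subgroup (Sp n F)) : Set (Sp n F)) =
          blockSet P hmn U (Subgroup.centralizer {U₁} ⊓ Subgroup.centralizer {U₂}))) := by
  have h2 : (2 : F) ≠ 0 := by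
    have := Fintype.ofFinite F
    refine Ring.two_ne_zero fun hchar => ?_
    rw [Nat.card_eq_fintype_card] at hq
    exact Nat.not_even_iff_odd.2 hq (Nat.even_iff.2 (FiniteField.even_card_of_char_two hchar))
  have hiso : ∀ x ∈ fixedSpace U.1, ∀ y ∈ fixedSpace U.1, x ⬝ᵥ formQ m F *ᵥ y = 0 :=
    fun x hx y hy => dotProduct_formQ_mulVec_eq_zero_of_hasType hlam hweight hx hy
  -- a single element `U` is treated as the pair `U, 1`
  have hone₁ : fixedSpace (U * 1).1 ≤ fixedSpace U.1 := by rw [mul_one]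
  have hone₂ : fixedSpace (U * 1).1 ≤ fixedSpace (1 : Sp m F).1 := fun v _ => by
    rw [mem_fixedSpace_iff]
    exact one_mulVec v
  subst hd
  refine ⟨?_, ?_, exists_isPivotal_conj U hiso, fun P hP => ⟨?_, ?_⟩⟩
  · have h := card_centralizer_upup_inf h2 hmn hone₁ hone₂ (by rwa [mul_one])
    rwa [upup_one, centralizer_inf_centralizer_one, centralizer_inf_centralizer_one, mul_one] at h
  · rintro U₁ U₂ rfl hrl
    have hfix := fixedSpace_mul_le_of_rl_add hrl
    exact card_centralizer_upup_inf h2 hmn (hfix.trans inf_le_left) (hfix.trans inf_le_right) hiso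
  · have h := image_centralizer_eq_blockSet h2 hmn hone₁ hone₂ (P := P) (by rwa [mul_one])
      (hP.swap_notMem hiso)
    rwa [upup_one, centralizer_inf_centralizer_one, centralizer_inf_centralizer_one, mul_one] at h
  · rintro U₁ U₂ rfl hrl
    have hfix := fixedSpace_mul_le_of_rl_add hrl
    exact image_centralizer_eq_blockSet h2 hmn (hfix.trans inf_le_left) (hfix.trans inf_le_right)
      hP (hP.swap_notMem hiso)
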